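/- Let $n\ge 2$. For a Borel probability measure $\mu$ on $\mathbb R^n$ let $\hat\mu(\xi)=\int e^{-2\pi i\xi\cdot v}\mu(dv)$, and for two such measures let $d_2(\mu,\nu)=\sup_{\xi\ne 0}|\hat\mu(\xi)-\hat\nu(\xi)|/|\xi|^2\in[0,\infty]$. Let $R_\mu$ be the angular average of $\mu$ (each point $v$ is replaced by a uniformly distributed point of the sphere of radius $|v|$ about $0$). Let $Q=\binom n2^{-1}\sum_{i<j}Q_{i,j}$ be the Kac collision operator, where $Q_{i,j}$ rotates $(v_i,v_j)$ to $(v_i\cos\theta-v_j\sin\theta,\ v_i\sin\theta+v_j\cos\theta)$ with $\theta$ uniform on $[0,2\pi]$, and let $e^{-tL}$, $-L=n(Q-I)$, be the Kac evolution (rate $\lambda=1$). A density is identified with the measure it defines. **Theorem.** (a) For every $n\ge 2$ there is $\alpha_0>0$ such that for every $\alpha\ge\alpha_0$ there is $B_0>0$ such that for every $B\ge B_0$ the function $$f_0(v)=\Big(\frac{0.9\,\pi}{1+\alpha}\Big)^{n/2}e^{-\frac{0.9\,\pi^2}{1+\alpha}|v|^2}+\frac1{B(2\pi)^4}\,\Delta^2\prod_{i=1}^n\Big(\sqrt\pi\,e^{-\pi^2v_i^2}-\sqrt{\tfrac{\pi}{1+\alpha}}\,e^{-\frac{\pi^2}{1+\alpha}v_i^2}\Big)$$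 is a Schwartz probability density on $\mathbb R^n$, symmetric in its variables, whose Fourier transform is $$\hat f_0(\xi)=e^{-\frac{1+\alpha}{0.9}|\xi|^2}+\frac1B|\xi|^4e^{-|\xi|^2}\prod_{i=1}^n\big(1-e^{-\alpha\xi_i^2}\big),$$ and which satisfies $0<d_2(f_0,R_{f_0})<\infty$ and, for all $t\ge 0$, $$d_2(f_0,R_{f_0})\ \ge\ d_2(e^{-tL}f_0,R_{f_0})\ \ge\ \max\Big\{d_2(f_0,R_{f_0})\Big(1-\frac en(2t)^{n-1}\Big),\,0\Big\}.$$ In particular $d_2(e^{-tL}f_0,R_{f_0})\ge(1-\frac en)\,d_2(f_0,R_{f_0})$ for $0\le t\le\frac12$, and if $n\ge 3$, the right derivative of $t\mapsto d_2(e^{-tL}f_0,R_{f_0})$ at $t=0$ exists and equals $0$. (b) Consequently the following Cercignani-type statement (C) is false: there is $a>0$, independent of $n$ and $\mu$, such that for every $n\ge 2$ and every Borel probability measure $\mu$ on $\mathbb R^n$ with finite second moment and zero mean, if $d_2(\mu,R_\mu)>0$ and $t\mapsto d_2(e^{-tL}\mu,R_\mu)$ $(t\ge 0)$ is differentiable at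 $t=0$, then $$-\frac{1}{d_2(\mu,R_\mu)}\,\frac{d}{dt}\Big|_{t=0^+}d_2(e^{-tL}\mu,R_\mu)\ \ge\ a.$$ -/

import Mathlib

open MeasureTheory ProbabilityTheory
open scoped ENNReal SchwartzMap

noncomputable section

/-- The velocity space `ℝⁿ` with its Euclidean norm. -/
abbrev Vel (n : ℕ) : Type := EuclideanSpace ℝ (Fin n)

/-- The binary collision of particles `i` and `j` with scattering angle `θ`:
`(v_i, v_j) ↦ (v_i cos θ - v_j sin θ, v_i sin θ + v_j cos θ)`, all other velocities unchanged. -/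
def collide {n : ℕ} (i j : Fin n) (θ : ℝ) (v : Vel n) : Vel n :=
  WithLp.toLp 2 fun k =>
    if k = i then v i * Real.cos θ - v j * Real.sin θ
    else if k = j then v i * Real.sin θ + v j * Real.cos θ
    else v k

/-- The operator `Q_{i,j}` on measures: the law of the velocities after a collision of `i` and `j`
with an angle uniform on `[0, 2π]`. For a measure with density `f` this has the density
`v ↦ (2π)⁻¹ ∫_0^{2π} f (collide i j θ v) dθ`, since collisions are rotations and the
inverse of the one with angle `θ` is the one with angle `-θ`. -/
def kacPair {n : ℕ} (i j : Fin n) (μ : Measure (Vel n)) : Measure (Vel n) :=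
  (μ.prod (ProbabilityTheory.cond (volume : Measure ℝ) (Set.Icc 0 (2 * Real.pi)))).map
    fun p => collide i j p.2 p.1

/-- The collision operator `Q = (n choose 2)⁻¹ ∑_{i<j} Q_{i,j}`. -/
def kacQ {n : ℕ} (μ : Measure (Vel n)) : Measure (Vel n) :=
  ((n.choose 2 : ℕ) : ℝ≥0∞)⁻¹ •
    ∑ p ∈ Finset.univ.filter (fun p : Fin n × Fin n => p.1 < p.2), kacPair p.1 p.2 μ

/-- The Kac evolution `e^{-tL} μ`, `t ≥ 0`, with generator `-L = n (Q - I)` (rate `λ = 1`), through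
the power series `e^{-tL} = e^{-nt} e^{ntQ} = ∑_k e^{-nt} (nt)^k / k! Q^k`. -/
def kacEvolution {n : ℕ} (t : ℝ) (μ : Measure (Vel n)) : Measure (Vel n) :=
  Measure.sum fun k : ℕ =>
    ENNReal.ofReal (Real.exp (-(n * t)) * (n * t) ^ k / (k.factorial : ℝ)) • (kacQ^[k] μ)

/-- The uniform probability measure on the unit sphere of `ℝⁿ`, as a measure on `ℝⁿ`. -/
def unitSphereLaw (n : ℕ) : Measure (Vel n) :=
  (((volume : Measure (Vel n)).toSphere Set.univ)⁻¹ • (volume : Measure (Vel n)).toSphere).map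
    (Subtype.val : Metric.sphere (0 : Vel n) 1 → Vel n)

/-- The angular average `R_μ`: every point `v` is replaced by a uniformly distributed point on the
sphere of radius `‖v‖` about the origin. -/
def angularAverage {n : ℕ} (μ : Measure (Vel n)) : Measure (Vel n) :=
  (μ.prod (unitSphereLaw n)).map fun p => ‖p.1‖ • p.2

/-- The Fourier transform `∫ e^{-2π i ξ·v} μ(dv)` of a finite measure. -/
def measureFourier {n : ℕ} (μ : Measure (Vel n)) (ξ : Vel n) : ℂ :=
  ∫ v, Complex.exp (-(2 * Real.pi * (inner ℝ ξ v : ℝ) : ℂ) * Complex.I) ∂μ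

/-- The Gabetta-Toscani-Wennberg distance
`d₂(μ, ν) = sup_{ξ ≠ 0} |μ̂(ξ) - ν̂(ξ)| / |ξ|²`, possibly infinite. -/
def gtwDist {n : ℕ} (μ ν : Measure (Vel n)) : ℝ≥0∞ :=
  ⨆ (ξ : Vel n) (_ : ξ ≠ 0),
    ENNReal.ofReal (‖measureFourier μ ξ - measureFourier ν ξ‖ / ‖ξ‖ ^ 2)

/-- The measure with density `f` with respect to Lebesgue measure. -/
def densityLaw {n : ℕ} (f : Vel n → ℝ) : Measure (Vel n) :=
  (volume : Measure (Vel n)).withDensity fun v => ENNReal.ofReal (f v)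

/-- The function `∏_i (√π e^{-π² v_i²} - √(π/(1+α)) e^{-π² v_i²/(1+α)})`, the inverse Fourier
transform of `e^{-|ξ|²} ∏_i (1 - e^{-α ξ_i²})`. -/
def slowProfile (n : ℕ) (α : ℝ) (v : Vel n) : ℝ :=
  ∏ i : Fin n, (√Real.pi * Real.exp (-(Real.pi ^ 2 * v i ^ 2)) -
    √(Real.pi / (1 + α)) * Real.exp (-(Real.pi ^ 2 / (1 + α) * v i ^ 2)))

/-- The density `f₀`: a centred Gaussian probability density of high temperature plus
`1 / (B (2π)⁴)` times the bilaplacian of `slowProfile`. -/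
def slowDensity (n : ℕ) (α B : ℝ) (v : Vel n) : ℝ :=
  (0.9 * Real.pi / (1 + α)) ^ ((n : ℝ) / 2) *
      Real.exp (-(0.9 * Real.pi ^ 2 / (1 + α) * ‖v‖ ^ 2)) +
    1 / (B * (2 * Real.pi) ^ 4) *
      Laplacian.laplacian (Laplacian.laplacian (slowProfile n α)) v

/-- The Cercignani-type statement (C) for `d₂`: there is `a > 0`, independent of `n` and `μ`, such
that for every Borel probability measure `μ` on `ℝⁿ` with finite second moment, zero mean and
`d₂(μ, R_μ) > 0` for which `t ↦ d₂(e^{-tL} μ, R_μ)`, `t ≥ 0`, has a derivative `D` at `t = 0`, the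
relative initial decay rate `-D / d₂(μ, R_μ)` is at least `a`. -/
def CercignaniGTW : Prop :=
  ∃ a : ℝ, 0 < a ∧ ∀ n : ℕ, 2 ≤ n → ∀ μ : Measure (Vel n), IsProbabilityMeasure μ →
    Integrable (fun v => ‖v‖ ^ 2) μ → (∫ v, v ∂μ) = 0 → 0 < gtwDist μ (angularAverage μ) →
    ∀ D : ℝ,
      HasDerivWithinAt (fun t : ℝ => (gtwDist (kacEvolution t μ) (angularAverage μ)).toReal)
        D (Set.Ici 0) 0 →
      a ≤ -D / (gtwDist μ (angularAverage μ)).toReal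

end

/-! On the Fourier side a collision rotates two coordinates of the frequency, so the transform of
`e^{-tL} f₀` at `ξ` averages `f̂₀` over a Poisson(`nt`) number of random collisions of `ξ`. The
transform of `R_{f₀}` at `ξ` is the mean of `f̂₀` over the sphere through `ξ`. Collisions preserve
spheres, hence the distance to `R_{f₀}` cannot exceed its initial value.

For the lower bound, `f̂₀` is a radial function plus `B⁻¹ |ξ|⁴ e^{-|ξ|²} P(ξ)`, where `P = ∏ (1 -
e^{-α ξ_i²})` vanishes whenever a coordinate does, while for large `α` its spherical mean `m` is
close to 1 away from the origin. The quotient in `d₂` is `B⁻¹ |ξ|² e^{-|ξ|²} |P - m|`, and its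
supremum is controlled by the axes, where `P = 0` and the defect is the full mean `m`. A frequency
on an axis sees the perturbation only once all its coordinates are nonzero. This takes `n - 1`
collisions, each adding one new particle to its support. Choosing which collisions do so gives the
bound `C(k, n-1) ∏ l(n-l)/C(n,2)` after `k` collisions
(`norm_measureFourier_kacQ_iterate_sub_le_choose`), and the Poisson average is at most
`(2/n)(2t)^{n-1}`. Comparison with `d₂(f₀, R_{f₀}) ≥ (3/4) e⁻¹/B` turns this into the relative loss
`(e/n)(2t)^{n-1}`, which is `O(t²)` for `n ≥ 3` and refutes (C).

Positivity of `f₀` for large `B` holds because the bilaplacian term is dominated by the wider main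
Gaussian (`HasGaussianWeight`). -/

noncomputable section

/-! ### Exponentials of quadratic-like functions are Schwartz -/

section Schwartz

open scoped Laplacian LineDeriv

/-- The power is at most `m! e^{1+r}`, and completing the square gives `r - c r² ≤ 1/(4c)`. -/
theorem one_add_pow_mul_exp_neg_sq_le {c : ℝ} (hc : 0 < c) (m : ℕ) {r : ℝ} (hr : 0 ≤ r) :
    (1 + r) ^ m * Real.exp (-(c * r ^ 2)) ≤ m.factorial * Real.exp (1 + 1 / (4 * c)) := by
  have h1 : (1 + r) ^ m ≤ m.factorial * Real.exp (1 + r) := by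
    have := Real.pow_div_factorial_le_exp (1 + r) (by positivity) m
    rwa [div_le_iff₀ (by positivity), mul_comm] at this
  calc (1 + r) ^ m * Real.exp (-(c * r ^ 2))
      ≤ (m.factorial * Real.exp (1 + r)) * Real.exp (-(c * r ^ 2)) := by gcongr
    _ = m.factorial * Real.exp (1 + r + -(c * r ^ 2)) := by rw [mul_assoc, ← Real.exp_add]
    _ ≤ _ := by
      gcongr ?_ * Real.exp ?_
      have : 1 / (4 * c) - (r - c * r ^ 2) = c * (r - 1 / (2 * c)) ^ 2 := by
        field_simp; ring
      have h2 : 0 ≤ c * (r - 1 / (2 * c)) ^ 2 := by positivity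
      linarith

theorem norm_iteratedFDeriv_exp_neg (i : ℕ) (t : ℝ) :
    ‖iteratedFDeriv ℝ i (fun s : ℝ => Real.exp (-s)) t‖ = Real.exp (-t) := by
  rw [norm_iteratedFDeriv_eq_norm_iteratedDeriv]
  have : iteratedDeriv i (fun s : ℝ => Real.exp (-s)) t = (-1) ^ i * Real.exp (-t) := by
    have := iteratedDeriv_comp_neg i Real.exp t
    simpa [iteratedDeriv_eq_iterate, Real.iter_deriv_exp] using this
  rw [this, norm_mul]
  simp

variable {E : Type*} [NormedAddCommGroup E] [NormedSpace ℝ E]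

/-- All derivatives of `e^{-s}` have size `e^{-s}` and those of `q` grow polynomially, so by the
estimate for derivatives of a composition every derivative is a polynomial times `e^{-q} ≤
e^{-c|x|²}`. -/
theorem exists_schwartz_exp_neg {q : E → ℝ} (hq : q.HasTemperateGrowth) {c : ℝ} (hc : 0 < c)
    (hle : ∀ x, c * ‖x‖ ^ 2 ≤ q x) : ∃ g : 𝓢(E, ℝ), ∀ x, g x = Real.exp (-(q x)) := by
  have hcont : ContDiff ℝ (⊤ : ℕ∞) (fun x => Real.exp (-(q x))) := hq.1.neg.exp
  refine ⟨⟨fun x => Real.exp (-(q x)), hcont, fun k n => ?_⟩, fun x => rfl⟩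
  obtain ⟨K, C, hC0, hC⟩ := hq.norm_iteratedFDeriv_le_uniform n
  refine ⟨n.factorial * (max C 1) ^ n *
    ((k + K * n).factorial * Real.exp (1 + 1 / (4 * c))), fun x => ?_⟩
  have h1 : (1 : ℝ) ≤ 1 + ‖x‖ := by linarith [norm_nonneg x]
  have key : ‖iteratedFDeriv ℝ n ((fun s : ℝ => Real.exp (-s)) ∘ q) x‖ ≤
      n.factorial * Real.exp (-(q x)) * (max C 1 * (1 + ‖x‖) ^ K) ^ n := by
    refine norm_iteratedFDeriv_comp_le (N := (⊤ : ℕ∞)) (by fun_prop) hq.1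
      (mod_cast le_top) x (fun i _ => (norm_iteratedFDeriv_exp_neg i _).le) (fun i hi hin => ?_)
    -- The composition estimate wants the bound `D ^ i` on the `i`-th derivative; a base at least 1
    -- lets one uniform bound serve every `i ≥ 1`.
    have hA : (1 : ℝ) ≤ max C 1 * (1 + ‖x‖) ^ K :=
      one_le_mul_of_one_le_of_one_le (le_max_right _ _) (one_le_pow₀ h1)
    calc _ ≤ C * (1 + ‖x‖) ^ K := hC i hin x
      _ ≤ max C 1 * (1 + ‖x‖) ^ K := by gcongr; exact le_max_left _ _
      _ ≤ _ := le_self_pow₀ hA (by omega)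
  calc ‖x‖ ^ k * ‖iteratedFDeriv ℝ n (fun x => Real.exp (-(q x))) x‖
      ≤ (1 + ‖x‖) ^ k *
        (n.factorial * Real.exp (-(q x)) * (max C 1 * (1 + ‖x‖) ^ K) ^ n) := by
        gcongr
        · linarith
        · exact key
    _ = n.factorial * (max C 1) ^ n * ((1 + ‖x‖) ^ (k + K * n) * Real.exp (-(q x))) := by
        rw [mul_pow, pow_add, pow_mul]; ring
    _ ≤ n.factorial * (max C 1) ^ n * ((1 + ‖x‖) ^ (k + K * n) * Real.exp (-(c * ‖x‖ ^ 2))) := by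
        gcongr; exact hle x
    _ ≤ _ := by
        exact mul_le_mul_of_nonneg_left (one_add_pow_mul_exp_neg_sq_le hc _ (norm_nonneg x))
          (by positivity)

end Schwartz

/-! ### Functions with a Gaussian factor, and the Laplacian -/

section GaussianWeight

open scoped Laplacian LineDeriv

variable {E : Type*} [NormedAddCommGroup E] [InnerProductSpace ℝ E]

/-- A Schwartz function that is a Gaussian `e^{-c|x|²}` times a Schwartz function. -/
def HasGaussianWeight (c : ℝ) (f : 𝓢(E, ℝ)) : Prop :=
  ∃ h : 𝓢(E, ℝ), ∀ x, f x = Real.exp (-(c * ‖x‖ ^ 2)) * h x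

theorem HasGaussianWeight.sum {c : ℝ} {ι : Type*} {s : Finset ι} {f : ι → 𝓢(E, ℝ)}
    (hf : ∀ i ∈ s, HasGaussianWeight c (f i)) : HasGaussianWeight c (∑ i ∈ s, f i) := by
  choose! h hh using hf
  refine ⟨∑ i ∈ s, h i, fun x => ?_⟩
  simp only [sum_apply, Finset.mul_sum]
  exact Finset.sum_congr rfl fun i hi => hh i hi x

/-- Differentiating the Gaussian only produces the linear factor `-2c⟨x, m⟩`, which the Schwartz
cofactor absorbs. The exponent `c` is thus not degraded. -/
theorem HasGaussianWeight.lineDeriv {c : ℝ} {f : 𝓢(E, ℝ)} (hf : HasGaussianWeight c f) (m : E) :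
    HasGaussianWeight c (∂_{m} f) := by
  obtain ⟨h, hh⟩ := hf
  refine ⟨∂_{m} h - SchwartzMap.smulLeftCLM ℝ (fun x => 2 * c * inner ℝ x m) h, fun x => ?_⟩
  have hfe : (f : E → ℝ) = fun x => Real.exp (-(c * ‖x‖ ^ 2)) * h x := funext hh
  rw [SchwartzMap.lineDerivOp_apply_eq_fderiv, hfe, sub_apply,
    SchwartzMap.lineDerivOp_apply_eq_fderiv, SchwartzMap.smulLeftCLM_apply_apply (by fun_prop)]
  have h1 : HasFDerivAt (fun x : E => Real.exp (-(c * ‖x‖ ^ 2)))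
      (Real.exp (-(c * ‖x‖ ^ 2)) • (-(c • (2 • (innerSL ℝ x) : E →L[ℝ] ℝ)))) x :=
    (((hasStrictFDerivAt_norm_sq x).hasFDerivAt.const_mul c).fun_neg).exp
  rw [(h1.fun_mul (h.hasFDerivAt x)).fderiv]
  simp [real_inner_comm]
  ring

theorem HasGaussianWeight.laplacian [FiniteDimensional ℝ E] {c : ℝ} {f : 𝓢(E, ℝ)}
    (hf : HasGaussianWeight c f) : HasGaussianWeight c (Δ f) := by
  rw [SchwartzMap.laplacian_eq_sum (stdOrthonormalBasis ℝ E)]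
  exact .sum fun i _ => (hf.lineDeriv _).lineDeriv _

theorem HasGaussianWeight.exists_abs_le {c : ℝ} {f : 𝓢(E, ℝ)} (hf : HasGaussianWeight c f) :
    ∃ M, 0 < M ∧ ∀ x, |f x| ≤ M * Real.exp (-(c * ‖x‖ ^ 2)) := by
  obtain ⟨h, hh⟩ := hf
  obtain ⟨M, hM, hb⟩ := h.decay 0 0
  refine ⟨M, hM, fun x => ?_⟩
  have := hb x
  simp only [pow_zero, one_mul, norm_iteratedFDeriv_zero, Real.norm_eq_abs] at this
  rw [hh, abs_mul, Real.abs_exp, mul_comm]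
  gcongr

/-- The Laplacian can be computed in any orthonormal basis, and `L` carries one such basis to
another. The symmetries of `f₀` follow from those of its profile. -/
theorem laplacian_comp_linearIsometryEquiv [FiniteDimensional ℝ E] {F : Type*}
    [NormedAddCommGroup F] [NormedSpace ℝ F] (L : E ≃ₗᵢ[ℝ] E) (f : E → F) (x : E) :
    Δ (fun y => f (L y)) x = (Δ f) (L x) := by
  let b := stdOrthonormalBasis ℝ E
  rw [InnerProductSpace.laplacian_eq_iteratedFDeriv_orthonormalBasis _ b,
    InnerProductSpace.laplacian_eq_iteratedFDeriv_orthonormalBasis f (b.map L)]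
  refine Finset.sum_congr rfl fun i _ => ?_
  have : iteratedFDeriv ℝ 2 (fun y => f (L y)) x = (iteratedFDeriv ℝ 2 f
      (L x)).compContinuousLinearMap fun _ => (L.toContinuousLinearEquiv : E →L[ℝ] E) := by
    have := L.toContinuousLinearEquiv.iteratedFDerivWithin_comp_right f uniqueDiffOn_univ
        (Set.mem_univ (L x)) 2
    rw [Set.preimage_univ, iteratedFDerivWithin_univ, iteratedFDerivWithin_univ] at this
    exact this
  have h2 := congrArg (fun T => T ![b i, b i]) this
  simp only [ContinuousMultilinearMap.compContinuousLinearMap_apply] at h2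
  refine h2.trans ?_
  congr 1
  ext j
  fin_cases j <;> simp

end GaussianWeight

/-! ### The profile as a Schwartz function -/

section Profile

variable {n : ℕ}

theorem hasTemperateGrowth_sum_mul_sq (w : Fin n → ℝ) :
    Function.HasTemperateGrowth fun v : Vel n => ∑ i, w i * v i ^ 2 := by
  refine Function.HasTemperateGrowth.sum fun i _ => ?_
  have : Function.HasTemperateGrowth fun v : Vel n => v i :=
    (EuclideanSpace.proj (𝕜 := ℝ) i : Vel n →L[ℝ] ℝ).hasTemperateGrowth
  fun_prop

theorem exists_schwartz_exp_neg_sum (w : Fin n → ℝ) (hw : ∀ i, 0 < w i) :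
    ∃ g : 𝓢(Vel n, ℝ), ∀ v, g v = Real.exp (-∑ i, w i * v i ^ 2) := by
  obtain ⟨c, hc, hle⟩ : ∃ c : ℝ, 0 < c ∧ ∀ i, c ≤ w i := by
    rcases isEmpty_or_nonempty (Fin n) with h | h
    · exact ⟨1, one_pos, fun i => h.elim i⟩
    · obtain ⟨i, hi⟩ := Finite.exists_min w
      exact ⟨w i, hw i, hi⟩
  refine exists_schwartz_exp_neg (hasTemperateGrowth_sum_mul_sq w) hc fun v => ?_
  rw [EuclideanSpace.real_norm_sq_eq, Finset.mul_sum]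
  exact Finset.sum_le_sum fun i _ => mul_le_mul_of_nonneg_right (hle i) (sq_nonneg _)

/-- Expanding the product over subsets `S` gives a finite sum of exponentials of positive diagonal
quadratic forms. -/
theorem exists_schwartz_prod_sub (a b p q : ℝ) (hp : 0 < p) (hq : 0 < q) :
    ∃ g : 𝓢(Vel n, ℝ), ∀ v, g v =
      ∏ i, (a * Real.exp (-(p * v i ^ 2)) - b * Real.exp (-(q * v i ^ 2))) := by
  have (S : Finset (Fin n)) := exists_schwartz_exp_neg_sum (fun i => if i ∈ S then p else q)
    (fun i => by split_ifs <;> assumption)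
  choose G hG using this
  refine ⟨∑ S : Finset (Fin n), ((∏ i, if i ∈ S then a else -b) : ℝ) • G S, fun v => ?_⟩
  simp only [sub_eq_add_neg, sum_apply, smul_apply, hG, smul_eq_mul]
  rw [Fintype.prod_add]
  refine Finset.sum_congr rfl fun S _ => ?_
  rw [← Finset.sum_neg_distrib, Real.exp_sum, ← Finset.prod_mul_distrib]
  rw [← Finset.prod_mul_prod_compl S]
  congr 1
  · exact Finset.prod_congr rfl fun i hi => by simp [hi]
  · exact Finset.prod_congr rfl fun i hi => by simp [Finset.mem_compl.1 hi]

/-- The factor 0.9 makes `c` strictly smaller than both exponents of the profile. Dividing by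
`e^{-c|v|²}` therefore leaves a product of the same shape with positive exponents. -/
theorem exists_schwartz_slowProfile {α : ℝ} (hα : 0 < α) :
    ∃ f : 𝓢(Vel n, ℝ), (∀ v, f v = slowProfile n α v) ∧
      HasGaussianWeight (0.9 * Real.pi ^ 2 / (1 + α)) f := by
  set c := 0.9 * Real.pi ^ 2 / (1 + α) with hc
  have hpi : 0 < Real.pi ^ 2 := by positivity
  have hcq : c < Real.pi ^ 2 / (1 + α) := by
    rw [hc]; gcongr; linarith
  have hqp : Real.pi ^ 2 / (1 + α) < Real.pi ^ 2 := div_lt_self hpi (by linarith)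
  have hc0 : 0 < c := by positivity
  obtain ⟨h, hh⟩ := exists_schwartz_prod_sub (n := n) (√Real.pi) (√(Real.pi / (1 + α)))
    (Real.pi ^ 2 - c) (Real.pi ^ 2 / (1 + α) - c) (by linarith) (by linarith)
  obtain ⟨f, hf⟩ := exists_schwartz_prod_sub (n := n) (√Real.pi) (√(Real.pi / (1 + α)))
    (Real.pi ^ 2) (Real.pi ^ 2 / (1 + α)) hpi (by positivity)
  refine ⟨f, hf, h, fun v => ?_⟩
  rw [hf, hh, EuclideanSpace.real_norm_sq_eq, Finset.mul_sum, ← Finset.sum_neg_distrib,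
    Real.exp_sum, ← Finset.prod_mul_distrib]
  refine Finset.prod_congr rfl fun i _ => ?_
  rw [mul_sub, mul_left_comm, mul_left_comm _ (√(Real.pi / (1 + α))), ← Real.exp_add,
    ← Real.exp_add]
  ring_nf

end Profile

/-! ### Fourier transform, positivity and symmetry of the density -/

section FourierSide

open scoped Laplacian LineDeriv FourierTransform

theorem fourier_eq_integral_exp {n : ℕ} (f : Vel n → ℂ) (ξ : Vel n) :
    𝓕 f ξ = ∫ v, Complex.exp (-(2 * Real.pi * (inner ℝ ξ v : ℝ) : ℂ) * Complex.I) * f v := by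
  rw [Real.fourier_eq']
  congr 1 with v
  rw [smul_eq_mul, real_inner_comm]
  push_cast
  ring_nf

theorem integral_exp_mul_prod {n : ℕ} (φ : ℝ → ℂ) (ξ : Vel n) :
    ∫ v : Vel n, Complex.exp (-(2 * Real.pi * (inner ℝ ξ v : ℝ) : ℂ) * Complex.I) *
        ∏ i, φ (v i) =
      ∏ i, ∫ x : ℝ, Complex.exp (-(2 * Real.pi * (ξ i * x : ℝ) : ℂ) * Complex.I) * φ x := by
  rw [← (PiLp.volume_preserving_toLp (Fin n)).integral_comp
    (MeasurableEquiv.toLp 2 _).measurableEmbedding]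
  rw [← integral_fintype_prod_volume_eq_prod
    (f := fun i x => Complex.exp (-(2 * Real.pi * (ξ i * x : ℝ) : ℂ) * Complex.I) * φ x)]
  congr 1 with x
  rw [Finset.prod_mul_distrib, ← Complex.exp_sum]
  congr 2
  simp only [PiLp.inner_apply, RCLike.inner_apply, conj_trivial]
  push_cast
  rw [Finset.mul_sum, ← Finset.sum_neg_distrib, Finset.sum_mul]
  refine Finset.sum_congr rfl fun i _ => ?_
  ring

theorem integral_exp_mul_gaussian {s : ℝ} (hs : 0 < s) (y : ℝ) :
    ∫ x : ℝ, Complex.exp (-(2 * Real.pi * (y * x : ℝ) : ℂ) * Complex.I) *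
        ((√(Real.pi / s) * Real.exp (-(Real.pi ^ 2 / s * x ^ 2)) : ℝ) : ℂ) =
      (Real.exp (-(s * y ^ 2)) : ℂ) := by
  have hb : 0 < (Real.pi ^ 2 / s : ℝ) := by positivity
  have key := fourierIntegral_gaussian (b := ((Real.pi ^ 2 / s : ℝ) : ℂ))
    (by rwa [Complex.ofReal_re])
    ((-(2 * Real.pi * y) : ℝ) : ℂ)
  have h1 : ∀ x : ℝ, Complex.exp (-(2 * Real.pi * (y * x : ℝ) : ℂ) * Complex.I) *
        ((√(Real.pi / s) * Real.exp (-(Real.pi ^ 2 / s * x ^ 2)) : ℝ) : ℂ) =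
      (√(Real.pi / s) : ℂ) * (Complex.exp (Complex.I * ((-(2 * Real.pi * y) : ℝ) : ℂ) * x) *
        Complex.exp (-((Real.pi ^ 2 / s : ℝ) : ℂ) * x ^ 2)) := by
    intro x
    push_cast
    rw [mul_left_comm]
    congr 2
    · congr 1; ring
    · congr 1; ring
  simp only [h1]
  rw [integral_const_mul, key, ← mul_assoc]
  have h2 : (Real.pi / ((Real.pi ^ 2 / s : ℝ) : ℂ)) ^ (1 / 2 : ℂ) = (√(s / Real.pi) : ℂ) := by
    rw [Real.sqrt_eq_rpow, Complex.ofReal_cpow (by positivity)]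
    congr 1
    · push_cast
      field_simp
    · norm_num
  rw [h2, ← Complex.ofReal_mul, ← Real.sqrt_mul (by positivity)]
  have h3 : Real.pi / s * (s / Real.pi) = 1 := by field_simp
  rw [h3, Real.sqrt_one, Complex.ofReal_one, one_mul, Complex.ofReal_exp]
  congr 1
  push_cast
  have : (s : ℂ) ≠ 0 := by exact_mod_cast hs.ne'
  field_simp
  ring

theorem integrable_exp_mul_gaussian {s : ℝ} (hs : 0 < s) (y : ℝ) :
    Integrable fun x : ℝ => Complex.exp (-(2 * Real.pi * (y * x : ℝ) : ℂ) * Complex.I) *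
      ((√(Real.pi / s) * Real.exp (-(Real.pi ^ 2 / s * x ^ 2)) : ℝ) : ℂ) := by
  have h : Integrable fun x : ℝ =>
      ((√(Real.pi / s) * Real.exp (-(Real.pi ^ 2 / s) * x ^ 2) : ℝ) : ℂ) :=
    ((integrable_exp_neg_mul_sq (b := Real.pi ^ 2 / s) (by positivity)).const_mul _).ofReal
  simp only [neg_mul] at h
  refine h.bdd_mul (c := 1) (by fun_prop) (Filter.Eventually.of_forall fun x => ?_)
  rw [Complex.norm_exp]
  simp

variable {n : ℕ}

theorem integral_exp_mul_gaussian_prod {s : ℝ} (hs : 0 < s) (ξ : Vel n) :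
    ∫ v : Vel n, Complex.exp (-(2 * Real.pi * (inner ℝ ξ v : ℝ) : ℂ) * Complex.I) *
        ((∏ i, √(Real.pi / s) * Real.exp (-(Real.pi ^ 2 / s * v i ^ 2)) : ℝ) : ℂ) =
      (Real.exp (-(s * ‖ξ‖ ^ 2)) : ℂ) := by
  simp only [Complex.ofReal_prod]
  rw [integral_exp_mul_prod
    (fun x => ((√(Real.pi / s) * Real.exp (-(Real.pi ^ 2 / s * x ^ 2)) : ℝ) : ℂ))]
  simp only [integral_exp_mul_gaussian hs, ← Complex.ofReal_prod]
  rw [← Real.exp_sum, EuclideanSpace.real_norm_sq_eq, Finset.mul_sum, Finset.sum_neg_distrib]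

theorem integral_exp_mul_slowProfile {α : ℝ} (hα : 0 < α) (ξ : Vel n) :
    ∫ v : Vel n, Complex.exp (-(2 * Real.pi * (inner ℝ ξ v : ℝ) : ℂ) * Complex.I) *
        (slowProfile n α v : ℂ) =
      ((Real.exp (-‖ξ‖ ^ 2) * ∏ i, (1 - Real.exp (-(α * ξ i ^ 2))) : ℝ) : ℂ) := by
  have h1 : ∀ v, (slowProfile n α v : ℂ) = ∏ i,
      (((√(Real.pi / 1) * Real.exp (-(Real.pi ^ 2 / 1 * v i ^ 2)) : ℝ) : ℂ) -
      ((√(Real.pi / (1 + α)) * Real.exp (-(Real.pi ^ 2 / (1 + α) * v i ^ 2)) : ℝ) : ℂ)) := by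
    intro v
    simp [slowProfile]
  simp only [h1]
  rw [integral_exp_mul_prod
    (fun x => (((√(Real.pi / 1) * Real.exp (-(Real.pi ^ 2 / 1 * x ^ 2)) : ℝ) : ℂ) -
      ((√(Real.pi / (1 + α)) * Real.exp (-(Real.pi ^ 2 / (1 + α) * x ^ 2)) : ℝ) : ℂ)))]
  simp only [mul_sub]
  have h2 : ∀ i : Fin n, _ := fun i => integral_sub
    (integrable_exp_mul_gaussian (s := 1) one_pos (ξ i))
    (integrable_exp_mul_gaussian (s := 1 + α) (by linarith) (ξ i))
  simp only [h2]
  simp only [integral_exp_mul_gaussian one_pos, integral_exp_mul_gaussian (show 0 < 1 + α by linarith)]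
  rw [EuclideanSpace.real_norm_sq_eq, ← Finset.sum_neg_distrib, Real.exp_sum,
    ← Finset.prod_mul_distrib]
  push_cast
  refine Finset.prod_congr rfl fun i _ => ?_
  rw [mul_sub, mul_one, ← Complex.exp_add]
  congr 2
  · ring
  · ring

theorem slowProfile_fun_eq {α : ℝ} {f : 𝓢(Vel n, ℝ)} (hf : ∀ v, f v = slowProfile n α v) :
    slowProfile n α = f := funext fun v => (hf v).symm

/-- A real Schwartz function as a complex one. -/
def complexify (f : 𝓢(Vel n, ℝ)) : 𝓢(Vel n, ℂ) := f.postcompCLM Complex.ofRealCLM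

theorem complexify_apply (f : 𝓢(Vel n, ℝ)) (v : Vel n) : complexify f v = (f v : ℂ) := rfl

theorem complexify_laplacian (f : 𝓢(Vel n, ℝ)) : complexify (Δ f) = Δ (complexify f) := by
  ext v
  rw [complexify_apply, SchwartzMap.laplacian_apply, SchwartzMap.laplacian_apply]
  exact ((f.smooth 2).contDiffAt.laplacian_CLM_comp_left (l := Complex.ofRealCLM)).symm

theorem fourier_laplacian (f : 𝓢(Vel n, ℂ)) (ξ : Vel n) :
    𝓕 (Δ f) ξ = ((-((2 * Real.pi) ^ 2 * ‖ξ‖ ^ 2) : ℝ) : ℂ) * 𝓕 f ξ := by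
  rw [SchwartzMap.laplacian_eq_fourierMultiplierCLM, SchwartzMap.fourierMultiplierCLM_apply,
    FourierTransform.fourier_smul, FourierTransform.fourier_fourierInv_eq, smul_apply]
  have : (‖·‖ ^ 2 : Vel n → ℝ) = fun x => ‖x‖ ^ 2 := rfl
  rw [this, SchwartzMap.smulLeftCLM_apply_apply (by fun_prop)]
  simp only [Complex.real_smul]
  push_cast
  ring

theorem integral_exp_mul_bilaplacian_slowProfile {α : ℝ} (hα : 0 < α) (ξ : Vel n) :
    ∫ v : Vel n, Complex.exp (-(2 * Real.pi * (inner ℝ ξ v : ℝ) : ℂ) * Complex.I) *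
        (Δ (Δ (slowProfile n α)) v : ℂ) =
      (((2 * Real.pi) ^ 4 * ‖ξ‖ ^ 4 *
        (Real.exp (-‖ξ‖ ^ 2) * ∏ i, (1 - Real.exp (-(α * ξ i ^ 2)))) : ℝ) : ℂ) := by
  obtain ⟨f, hf, -⟩ := exists_schwartz_slowProfile (n := n) hα
  have h1 : ∀ v, (Δ (Δ (slowProfile n α)) v : ℂ) = Δ (Δ (complexify f)) v := by
    intro v
    rw [← complexify_laplacian, ← complexify_laplacian, complexify_apply,
      SchwartzMap.laplacian_apply, slowProfile_fun_eq hf, funext (SchwartzMap.laplacian_apply f)]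
  simp only [h1]
  rw [← fourier_eq_integral_exp, ← SchwartzMap.fourier_coe, fourier_laplacian, fourier_laplacian,
    SchwartzMap.fourier_coe, fourier_eq_integral_exp]
  simp only [complexify_apply, hf]
  rw [integral_exp_mul_slowProfile hα]
  push_cast
  ring

theorem slowGaussian_eq_prod {α : ℝ} (hα : 0 < α) (v : Vel n) :
    (0.9 * Real.pi / (1 + α)) ^ ((n : ℝ) / 2) *
      Real.exp (-(0.9 * Real.pi ^ 2 / (1 + α) * ‖v‖ ^ 2)) =
    ∏ i, √(Real.pi / ((1 + α) / 0.9)) * Real.exp (-(Real.pi ^ 2 / ((1 + α) / 0.9) * v i ^ 2)) := by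
  rw [Finset.prod_mul_distrib, Finset.prod_const, Finset.card_univ, Fintype.card_fin,
    ← Real.exp_sum, Finset.sum_neg_distrib, ← Finset.mul_sum, ← EuclideanSpace.real_norm_sq_eq,
    Real.sqrt_eq_rpow, ← Real.rpow_mul_natCast (by positivity)]
  congr 2
  · rw [div_div_eq_mul_div, mul_comm]
  · ring
  · rw [div_div_eq_mul_div, mul_comm (0.9 : ℝ)]

theorem exists_schwartz_slowGaussian {α : ℝ} (hα : 0 < α) :
    ∃ g : 𝓢(Vel n, ℝ), ∀ v, g v = (0.9 * Real.pi / (1 + α)) ^ ((n : ℝ) / 2) *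
      Real.exp (-(0.9 * Real.pi ^ 2 / (1 + α) * ‖v‖ ^ 2)) := by
  have hs : 0 < Real.pi ^ 2 / ((1 + α) / 0.9) := by positivity
  -- The coefficient 0 removes the second Gaussian, so its exponent is arbitrary.
  obtain ⟨g, hg⟩ := exists_schwartz_prod_sub (n := n) (√(Real.pi / ((1 + α) / 0.9))) 0
    _ _ hs hs
  refine ⟨g, fun v => ?_⟩
  rw [slowGaussian_eq_prod hα, hg]
  simp

theorem exists_schwartz_slowDensity {α : ℝ} (hα : 0 < α) (B : ℝ) :
    ∃ g : 𝓢(Vel n, ℝ), ∀ v, g v = slowDensity n α B v := by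
  obtain ⟨f, hf, -⟩ := exists_schwartz_slowProfile (n := n) hα
  obtain ⟨g, hg⟩ := exists_schwartz_slowGaussian (n := n) hα
  refine ⟨g + (1 / (B * (2 * Real.pi) ^ 4)) • Δ (Δ f), fun v => ?_⟩
  rw [add_apply, smul_apply, hg, slowDensity, SchwartzMap.laplacian_apply,
    slowProfile_fun_eq hf, funext (SchwartzMap.laplacian_apply f), smul_eq_mul]

/-- The bilaplacian is bounded by `M` times the very Gaussian whose amplitude in `f₀` is `A`. The
choice of `B₀` is exactly the condition `M / (B (2π)⁴) ≤ A`. -/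
theorem exists_slowDensity_nonneg {α : ℝ} (hα : 0 < α) :
    ∃ B₀ : ℝ, 0 < B₀ ∧ ∀ B, B₀ ≤ B → ∀ v, 0 ≤ slowDensity n α B v := by
  obtain ⟨f, hf, hw⟩ := exists_schwartz_slowProfile (n := n) hα
  obtain ⟨M, hM, hb⟩ := hw.laplacian.laplacian.exists_abs_le
  set A : ℝ := (0.9 * Real.pi / (1 + α)) ^ ((n : ℝ) / 2) with hA
  have hA0 : 0 < A := by positivity
  refine ⟨M / (A * (2 * Real.pi) ^ 4), by positivity, fun B hB v => ?_⟩
  have hB0 : 0 < B := lt_of_lt_of_le (by positivity) hB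
  have h1 := hb v
  rw [SchwartzMap.laplacian_apply, funext (SchwartzMap.laplacian_apply f)] at h1
  rw [slowDensity, slowProfile_fun_eq hf, ← hA]
  rw [div_le_iff₀ (by positivity)] at hB
  have h2 : 1 / (B * (2 * Real.pi) ^ 4) * M ≤ A := by
    rw [one_div, inv_mul_le_iff₀ (by positivity)]
    linarith
  have h3 := (abs_le.1 h1).1
  set G := Real.exp (-(0.9 * Real.pi ^ 2 / (1 + α) * ‖v‖ ^ 2)) with hG
  have hG0 : 0 < G := Real.exp_pos _
  have h4 : 1 / (B * (2 * Real.pi) ^ 4) * (-(M * G)) ≤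
      1 / (B * (2 * Real.pi) ^ 4) * Δ (Δ (f : Vel n → ℝ)) v :=
    mul_le_mul_of_nonneg_left h3 (by positivity)
  have h5 := mul_le_mul_of_nonneg_right h2 hG0.le
  linarith

theorem integrable_exp_mul_schwartz (g : 𝓢(Vel n, ℝ)) (ξ : Vel n) :
    Integrable fun v : Vel n =>
      Complex.exp (-(2 * Real.pi * (inner ℝ ξ v : ℝ) : ℂ) * Complex.I) * (g v : ℂ) := by
  refine g.integrable.ofReal.bdd_mul (c := 1) (by fun_prop)
    (Filter.Eventually.of_forall fun x => ?_)
  rw [Complex.norm_exp]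
  simp

theorem integral_exp_mul_slowDensity {α : ℝ} (hα : 0 < α) {B : ℝ} (hB : 0 < B) (ξ : Vel n) :
    ∫ v : Vel n, Complex.exp (-(2 * Real.pi * (inner ℝ ξ v : ℝ) : ℂ) * Complex.I) *
        (slowDensity n α B v : ℂ) =
      ((Real.exp (-((1 + α) / 0.9 * ‖ξ‖ ^ 2)) +
            1 / B * (‖ξ‖ ^ 4 * Real.exp (-‖ξ‖ ^ 2) *
              ∏ i : Fin n, (1 - Real.exp (-(α * ξ i ^ 2)))) : ℝ) : ℂ) := by
  obtain ⟨f, hf, -⟩ := exists_schwartz_slowProfile (n := n) hα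
  obtain ⟨g, hg⟩ := exists_schwartz_slowGaussian (n := n) hα
  have hΔ : ∀ v, Δ (Δ f) v = Δ (Δ (slowProfile n α)) v := fun v => by
    rw [SchwartzMap.laplacian_apply, slowProfile_fun_eq hf, funext (SchwartzMap.laplacian_apply f)]
  have h1 := integrable_exp_mul_schwartz g ξ
  have h2 := (integrable_exp_mul_schwartz (Δ (Δ f)) ξ).const_mul
    ((1 / (B * (2 * Real.pi) ^ 4) : ℝ) : ℂ)
  have h3 : ∀ v : Vel n, Complex.exp (-(2 * Real.pi * (inner ℝ ξ v : ℝ) : ℂ) * Complex.I) *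
        (slowDensity n α B v : ℂ) =
      Complex.exp (-(2 * Real.pi * (inner ℝ ξ v : ℝ) : ℂ) * Complex.I) * (g v : ℂ) +
      ((1 / (B * (2 * Real.pi) ^ 4) : ℝ) : ℂ) *
        (Complex.exp (-(2 * Real.pi * (inner ℝ ξ v : ℝ) : ℂ) * Complex.I) *
          (Δ (Δ f) v : ℂ)) := by
    intro v
    rw [slowDensity, ← hg, ← hΔ]
    push_cast
    ring
  simp only [h3]
  rw [integral_add h1 h2, integral_const_mul]
  simp only [hΔ, hg, slowGaussian_eq_prod hα]
  rw [integral_exp_mul_gaussian_prod (by positivity), integral_exp_mul_bilaplacian_slowProfile hα]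
  have : (B : ℂ) ≠ 0 := by exact_mod_cast hB.ne'
  have hpi : (Real.pi : ℂ) ≠ 0 := by exact_mod_cast Real.pi_ne_zero
  push_cast
  field_simp

theorem slowDensity_comp_linearIsometryEquiv (L : Vel n ≃ₗᵢ[ℝ] Vel n) {α : ℝ}
    (hL : ∀ v, slowProfile n α (L v) = slowProfile n α v) (B : ℝ) (v : Vel n) :
    slowDensity n α B (L v) = slowDensity n α B v := by
  have h1 : (fun v => slowProfile n α (L v)) = slowProfile n α := funext hL
  have h2 : (fun v => Δ (slowProfile n α) (L v)) = Δ (slowProfile n α) := by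
    conv_rhs => rw [← h1]
    exact funext fun v => (laplacian_comp_linearIsometryEquiv L _ v).symm
  rw [slowDensity, slowDensity, L.norm_map, ← laplacian_comp_linearIsometryEquiv L, h2]

theorem slowDensity_perm (σ : Equiv.Perm (Fin n)) (α B : ℝ) (v : Vel n) :
    slowDensity n α B (WithLp.toLp 2 fun i => v (σ i)) = slowDensity n α B v := by
  have := slowDensity_comp_linearIsometryEquiv
    (LinearIsometryEquiv.piLpCongrLeft 2 ℝ ℝ σ.symm) (α := α) (fun v => ?_) B v
  · rw [← this]
    congr 1
  · simp only [slowProfile]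
    refine Fintype.prod_equiv σ _ _ fun i => ?_
    simp [LinearIsometryEquiv.piLpCongrLeft_apply]

theorem slowDensity_neg (α B : ℝ) (v : Vel n) :
    slowDensity n α B (-v) = slowDensity n α B v :=
  slowDensity_comp_linearIsometryEquiv (LinearIsometryEquiv.neg ℝ)
    (fun v => by simp [slowProfile]) B v

/-- This is the Fourier transform at the origin, where `|ξ|⁴` removes the perturbation. -/
theorem integral_slowDensity {α : ℝ} (hα : 0 < α) {B : ℝ} (hB : 0 < B) :
    ∫ v, slowDensity n α B v = 1 := by
  have := integral_exp_mul_slowDensity (n := n) hα hB 0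
  simp [integral_complex_ofReal] at this
  exact_mod_cast this

end FourierSide

/-! ### Measures given by a density -/

section DensityLaw

variable {n : ℕ}

theorem measureFourier_densityLaw {f : Vel n → ℝ} (hf : Measurable f) (h0 : ∀ v, 0 ≤ f v)
    (ξ : Vel n) : measureFourier (densityLaw f) ξ =
      ∫ v, Complex.exp (-(2 * Real.pi * (inner ℝ ξ v : ℝ) : ℂ) * Complex.I) * (f v : ℂ) := by
  rw [measureFourier, densityLaw, integral_withDensity_eq_integral_toReal_smul hf.ennreal_ofReal
    (Filter.Eventually.of_forall fun v => ENNReal.ofReal_lt_top)]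
  congr 1 with v
  rw [ENNReal.toReal_ofReal (h0 v), Complex.real_smul, mul_comm]

theorem isProbabilityMeasure_densityLaw {f : Vel n → ℝ} (h0 : ∀ v, 0 ≤ f v)
    (h1 : ∫ v, f v = 1) : IsProbabilityMeasure (densityLaw f) := by
  -- A non-integrable function would have integral 0 by convention.
  have hi : Integrable f := by
    by_contra h
    rw [integral_undef h] at h1
    exact zero_ne_one h1
  refine ⟨?_⟩
  rw [densityLaw, withDensity_apply _ MeasurableSet.univ, Measure.restrict_univ,
    ← ofReal_integral_eq_lintegral_ofReal hi (Filter.Eventually.of_forall h0), h1,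
    ENNReal.ofReal_one]

theorem integral_densityLaw_eq_zero {f : Vel n → ℝ} (hf : Measurable f)
    (heven : ∀ v, f (-v) = f v) : ∫ v, v ∂(densityLaw f) = 0 := by
  rw [densityLaw, integral_withDensity_eq_integral_toReal_smul hf.ennreal_ofReal
    (Filter.Eventually.of_forall fun v => ENNReal.ofReal_lt_top)]
  have h : ∫ v, (ENNReal.ofReal (f v)).toReal • v = -∫ v, (ENNReal.ofReal (f v)).toReal • v := by
    conv_lhs => rw [← integral_neg_eq_self]
    simp only [heven, smul_neg]
    exact integral_neg _
  have h2 := add_eq_zero_iff_eq_neg.2 h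
  rw [← two_smul ℝ] at h2
  exact (smul_eq_zero_iff_right two_ne_zero).1 h2

theorem integrable_norm_sq_densityLaw (g : 𝓢(Vel n, ℝ)) (h0 : ∀ v, 0 ≤ g v) :
    Integrable (fun v => ‖v‖ ^ 2) (densityLaw g) := by
  rw [densityLaw, integrable_withDensity_iff g.continuous.measurable.ennreal_ofReal
    (Filter.Eventually.of_forall fun v => ENNReal.ofReal_lt_top)]
  refine (g.integrable_pow_mul volume 2).congr (Filter.Eventually.of_forall fun v => ?_)
  simp [ENNReal.toReal_ofReal (h0 v), abs_of_nonneg (h0 v)]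

end DensityLaw

/-! ### The uniform law on the sphere and the angular average -/

section Sphere

open scoped Pointwise

variable {n : ℕ}

theorem unitSphereLaw_apply {S : Set (Vel n)} (hS : MeasurableSet S) :
    unitSphereLaw n S = ((volume : Measure (Vel n)).toSphere Set.univ)⁻¹ *
      (n * volume (Set.Ioo (0 : ℝ) 1 • (S ∩ Metric.sphere (0 : Vel n) 1))) := by
  rw [unitSphereLaw, Measure.map_apply measurable_subtype_coe hS, Measure.smul_apply,
    Measure.toSphere_apply' _ (measurable_subtype_coe hS), Subtype.image_preimage_coe,
    Set.inter_comm]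
  simp

instance isProbabilityMeasure_unitSphereLaw [NeZero n] :
    IsProbabilityMeasure (unitSphereLaw n) := by
  refine ⟨?_⟩
  rw [unitSphereLaw, Measure.map_apply measurable_subtype_coe MeasurableSet.univ, Set.preimage_univ,
    Measure.smul_apply, smul_eq_mul]
  refine ENNReal.inv_mul_cancel ?_ (measure_ne_top _ _)
  rw [Ne, Measure.measure_univ_eq_zero]
  exact Measure.toSphere_ne_zero _

theorem ae_unitSphereLaw_norm_eq_one : ∀ᵐ ω ∂(unitSphereLaw n), ‖ω‖ = 1 := by
  rw [unitSphereLaw, ae_map_iff measurable_subtype_coe.aemeasurable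
    (measurableSet_eq_fun measurable_norm measurable_const)]
  exact Filter.Eventually.of_forall fun x => mem_sphere_zero_iff_norm.1 x.2

/-- The surface measure of a set is `n` times the volume of the cone over it, and an isometry maps
cones to cones and preserves volume. -/
theorem map_unitSphereLaw (L : Vel n ≃ₗᵢ[ℝ] Vel n) :
    (unitSphereLaw n).map L = unitSphereLaw n := by
  ext S hS
  rw [Measure.map_apply L.continuous.measurable hS, unitSphereLaw_apply hS,
    unitSphereLaw_apply (L.continuous.measurable hS)]
  have : Set.Ioo (0 : ℝ) 1 • (L ⁻¹' S ∩ Metric.sphere (0 : Vel n) 1) =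
      L ⁻¹' (Set.Ioo (0 : ℝ) 1 • (S ∩ Metric.sphere (0 : Vel n) 1)) := by
    ext v
    simp only [Set.mem_smul, Set.mem_preimage, Set.mem_inter_iff, mem_sphere_zero_iff_norm]
    constructor
    · rintro ⟨r, hr, w, ⟨hw, hw1⟩, rfl⟩
      exact ⟨r, hr, L w, ⟨hw, by rwa [L.norm_map]⟩, (L.map_smul r w).symm⟩
    · rintro ⟨r, hr, w, ⟨hw, hw1⟩, h⟩
      refine ⟨r, hr, L.symm w, ⟨by simpa using hw, by rwa [L.symm.norm_map]⟩, ?_⟩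
      rw [← L.symm.map_smul, h, L.symm_apply_apply]
  rw [this]
  congr 2
  exact L.measurePreserving.measure_preimage_equiv (f := L.toHomeomorph.toMeasurableEquiv) _

/-- The cone over the exceptional set stays in a coordinate hyperplane, which has volume zero. -/
theorem ae_unitSphereLaw_apply_ne_zero (i : Fin n) : ∀ᵐ ω ∂(unitSphereLaw n), ω i ≠ 0 := by
  have hm : MeasurableSet {v : Vel n | v i = 0} :=
    measurableSet_eq_fun (by fun_prop) measurable_const
  rw [ae_iff]
  simp only [not_not]
  rw [unitSphereLaw_apply hm]
  have hnull : (volume : Measure (Vel n)) {v : Vel n | v i = 0} = 0 := by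
    have := Measure.addHaar_submodule (volume : Measure (Vel n))
      (LinearMap.ker (EuclideanSpace.proj (𝕜 := ℝ) i : Vel n →L[ℝ] ℝ).toLinearMap) (fun h => by
        have h1 : EuclideanSpace.single i (1 : ℝ) ∈ LinearMap.ker
          (EuclideanSpace.proj (𝕜 := ℝ) i : Vel n →L[ℝ] ℝ).toLinearMap := h ▸ Submodule.mem_top
        simp at h1)
    exact this
  have hsub : Set.Ioo (0 : ℝ) 1 • ({v : Vel n | v i = 0} ∩ Metric.sphere (0 : Vel n) 1) ⊆
      {v : Vel n | v i = 0} := by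
    rintro _ ⟨r, -, w, ⟨hw, -⟩, rfl⟩
    have : w i = 0 := hw
    simp [this]
  rw [measure_mono_null hsub hnull, mul_zero, mul_zero]

/-- The reflection in the hyperplane orthogonal to `ξ - η` exchanges the two vectors and preserves
the law. -/
theorem measureFourier_unitSphereLaw_eq {ξ η : Vel n} (h : ‖ξ‖ = ‖η‖) :
    measureFourier (unitSphereLaw n) ξ = measureFourier (unitSphereLaw n) η := by
  let L : Vel n ≃ₗᵢ[ℝ] Vel n := (ℝ ∙ (ξ - η))ᗮ.reflection
  have hL : L ξ = η := Submodule.reflection_sub h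
  rw [← hL]
  conv_rhs => rw [measureFourier, ← map_unitSphereLaw L]
  rw [integral_map L.continuous.measurable.aemeasurable (by fun_prop)]
  simp only [LinearIsometryEquiv.inner_map_map]
  rfl

theorem norm_exp_neg_mul_I (x : ℝ) :
    ‖Complex.exp (-(2 * Real.pi * (x : ℝ) : ℂ) * Complex.I)‖ = 1 := by
  rw [Complex.norm_exp]
  simp

/-- Since the transform of the sphere law is radial, `|v| ξ` may be replaced by `|ξ| v` in it;
Fubini then exchanges the roles of `v` and `ω`. -/
theorem measureFourier_angularAverage [NeZero n] (μ : Measure (Vel n)) [IsFiniteMeasure μ]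
    (ξ : Vel n) : measureFourier (angularAverage μ) ξ =
      ∫ ω, measureFourier μ (‖ξ‖ • ω) ∂(unitSphereLaw n) := by
  have hint : ∀ F : Vel n × Vel n → ℝ, Continuous F → Integrable
      (fun p => Complex.exp (-(2 * Real.pi * (F p : ℝ) : ℂ) * Complex.I))
      (μ.prod (unitSphereLaw n)) := fun F hF =>
    (integrable_const (1 : ℝ)).mono' (by fun_prop)
      (Filter.Eventually.of_forall fun p => (norm_exp_neg_mul_I _).le)
  rw [measureFourier, angularAverage, integral_map (by fun_prop) (by fun_prop)]
  rw [integral_prod _ (hint (fun p => inner ℝ ξ (‖p.1‖ • p.2)) (by fun_prop))]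
  have h1 : ∀ v : Vel n, ∫ ω, Complex.exp (-(2 * Real.pi * (inner ℝ ξ (‖v‖ • ω) : ℝ) : ℂ) *
      Complex.I) ∂(unitSphereLaw n) = ∫ ω, Complex.exp (-(2 * Real.pi *
        (inner ℝ (‖ξ‖ • ω) v : ℝ) : ℂ) * Complex.I) ∂(unitSphereLaw n) := by
    intro v
    have := measureFourier_unitSphereLaw_eq (ξ := ‖v‖ • ξ) (η := ‖ξ‖ • v) (by
      simp [norm_smul, mul_comm])
    simpa only [measureFourier, inner_smul_left, inner_smul_right, conj_trivial,
      real_inner_comm v] using this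
  simp only [h1]
  exact integral_integral_swap
    (hint (fun p => inner ℝ (‖ξ‖ • p.2) p.1) (by fun_prop))

theorem measureFourier_angularAverage_eq_of_norm_eq [NeZero n] (μ : Measure (Vel n))
    [IsFiniteMeasure μ] {ξ η : Vel n} (h : ‖ξ‖ = ‖η‖) :
    measureFourier (angularAverage μ) ξ = measureFourier (angularAverage μ) η := by
  rw [measureFourier_angularAverage, measureFourier_angularAverage, h]

end Sphere

/-! ### The product factor and its spherical mean -/

section CoordinateFactor

variable {n : ℕ}

/-- The function `∏_i (1 - e^{-α ξ_i²})`, which vanishes as soon as one coordinate does. -/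
def coordFactor (α : ℝ) (ξ : Vel n) : ℝ := ∏ i, (1 - Real.exp (-(α * ξ i ^ 2)))

theorem coordFactor_nonneg {α : ℝ} (hα : 0 ≤ α) (ξ : Vel n) : 0 ≤ coordFactor α ξ :=
  Finset.prod_nonneg fun i _ => by
    have : Real.exp (-(α * ξ i ^ 2)) ≤ 1 := Real.exp_le_one_iff.2 (by
      have := mul_nonneg hα (sq_nonneg (ξ i)); linarith)
    linarith

theorem coordFactor_le_one {α : ℝ} (hα : 0 ≤ α) (ξ : Vel n) : coordFactor α ξ ≤ 1 :=
  Finset.prod_le_one (fun i _ => by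
    have : Real.exp (-(α * ξ i ^ 2)) ≤ 1 := Real.exp_le_one_iff.2 (by
      have := mul_nonneg hα (sq_nonneg (ξ i)); linarith)
    linarith) fun i _ => by linarith [Real.exp_pos (-(α * ξ i ^ 2))]

theorem coordFactor_eq_zero (α : ℝ) {ξ : Vel n} {i : Fin n} (h : ξ i = 0) :
    coordFactor α ξ = 0 :=
  Finset.prod_eq_zero (Finset.mem_univ i) (by simp [h])

theorem continuous_coordFactor (α : ℝ) : Continuous (coordFactor α : Vel n → ℝ) := by
  unfold coordFactor
  fun_prop

/-- The mean of `coordFactor α` over the sphere of radius `r`. -/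
def coordMean (n : ℕ) (α r : ℝ) : ℝ := ∫ ω : Vel n, coordFactor α (r • ω) ∂(unitSphereLaw n)

theorem integrable_coordFactor [NeZero n] {α : ℝ} (hα : 0 ≤ α) (r : ℝ) :
    Integrable (fun ω : Vel n => coordFactor α (r • ω)) (unitSphereLaw n) :=
  (integrable_const (1 : ℝ)).mono'
    ((continuous_coordFactor α).comp (by fun_prop)).aestronglyMeasurable
    (Filter.Eventually.of_forall fun ω => by
      rw [Real.norm_eq_abs, abs_of_nonneg (coordFactor_nonneg hα _)]
      exact coordFactor_le_one hα _)

theorem coordMean_nonneg {α : ℝ} (hα : 0 ≤ α) (r : ℝ) : 0 ≤ coordMean n α r :=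
  integral_nonneg fun _ => coordFactor_nonneg hα _

theorem coordMean_le_one [NeZero n] {α : ℝ} (hα : 0 ≤ α) (r : ℝ) : coordMean n α r ≤ 1 := by
  have := integral_mono (integrable_coordFactor (n := n) hα r) (integrable_const (1 : ℝ))
    fun ω => coordFactor_le_one hα _
  simpa [coordMean] using this

/-- The mean depends on `α` and `r` only through `α r²`. As this tends to infinity the factor tends
to 1 off the null set of coordinate hyperplanes, and dominated convergence applies. -/
theorem exists_le_coordMean (n : ℕ) [NeZero n] {β ρ : ℝ} (hβ : β < 1) (hρ : 0 < ρ) :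
    ∃ α₀ : ℝ, 0 < α₀ ∧ ∀ α, α₀ ≤ α → ∀ r : ℝ, ρ ≤ r ^ 2 → β ≤ coordMean n α r := by
  have hlim : Filter.Tendsto (fun k : ℝ => ∫ ω : Vel n, coordFactor k ω ∂(unitSphereLaw n))
      Filter.atTop (nhds (∫ _ω : Vel n, (1 : ℝ) ∂(unitSphereLaw n))) := by
    refine tendsto_integral_filter_of_dominated_convergence (fun _ => 1)
      (Filter.Eventually.of_forall fun k => (continuous_coordFactor k).aestronglyMeasurable)
      ?_ (integrable_const _) ?_
    · filter_upwards [Filter.eventually_ge_atTop 0] with k hk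
      refine Filter.Eventually.of_forall fun ω => ?_
      rw [Real.norm_eq_abs, abs_of_nonneg (coordFactor_nonneg hk _)]
      exact coordFactor_le_one hk _
    · have hne : ∀ᵐ ω ∂(unitSphereLaw n), ∀ i, ω i ≠ 0 :=
        ae_all_iff.2 ae_unitSphereLaw_apply_ne_zero
      filter_upwards [hne] with ω hω
      have : Filter.Tendsto (fun k : ℝ => coordFactor k ω) Filter.atTop
          (nhds (∏ _i : Fin n, (1 - 0))) := by
        refine tendsto_finsetProd _ fun i _ => tendsto_const_nhds.sub ?_
        refine Real.tendsto_exp_neg_atTop_nhds_zero.comp ?_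
        exact Filter.tendsto_id.atTop_mul_const (by have := hω i; positivity)
      simpa using this
  simp only [integral_const, probReal_univ, one_smul] at hlim
  obtain ⟨K, hK⟩ := Filter.eventually_atTop.1 (hlim.eventually (lt_mem_nhds hβ))
  -- With `r² ≥ ρ` this forces `α r² ≥ K`; the maximum with 1 keeps `α₀` positive.
  refine ⟨max K 1 / ρ, by positivity, fun α hα r hr => ?_⟩
  rw [div_le_iff₀ hρ] at hα
  have hα0 : 0 ≤ α := by
    by_contra h
    have : α * ρ < 0 := mul_neg_of_neg_of_pos (not_le.1 h) hρ
    linarith [le_max_right K 1]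
  have := hK (α * r ^ 2) ((le_max_left K 1).trans (hα.trans (by gcongr)))
  refine this.le.trans (le_of_eq ?_)
  unfold coordMean coordFactor
  congr 1 with ω
  refine Finset.prod_congr rfl fun i _ => ?_
  simp only [PiLp.smul_apply, smul_eq_mul]
  ring_nf

end CoordinateFactor

/-! ### Collisions on the Fourier side and growth of the support -/

section Collision

variable {n : ℕ}

theorem collide_apply (i j : Fin n) (θ : ℝ) (v : Vel n) (k : Fin n) :
    collide i j θ v k = if k = i then v i * Real.cos θ - v j * Real.sin θ
    else if k = j then v i * Real.sin θ + v j * Real.cos θ else v k := rfl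

theorem continuous_collide (i j : Fin n) :
    Continuous fun p : Vel n × ℝ => collide i j p.2 p.1 := by
  refine (PiLp.continuous_toLp 2 _).comp (continuous_pi fun k => ?_)
  split_ifs <;> fun_prop

theorem sum_eq_zero_of_pair {i j : Fin n} (hij : i ≠ j) {d : Fin n → ℝ} (h : d i + d j = 0)
    (h0 : ∀ k, k ≠ i → k ≠ j → d k = 0) : ∑ k, d k = 0 := by
  rw [← Finset.sum_subset (Finset.subset_univ {i, j}) fun k _ hk => ?_, Finset.sum_pair hij, h]
  simp only [Finset.mem_insert, Finset.mem_singleton, not_or] at hk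
  exact h0 k hk.1 hk.2

/-- The adjoint of a rotation is its inverse; this moves collisions from velocities to frequencies.
-/
theorem inner_collide {i j : Fin n} (hij : i ≠ j) (θ : ℝ) (ξ v : Vel n) :
    inner ℝ ξ (collide i j θ v) = inner ℝ (collide i j (-θ) ξ) v := by
  simp only [PiLp.inner_apply, RCLike.inner_apply, conj_trivial]
  rw [← sub_eq_zero, ← Finset.sum_sub_distrib]
  refine sum_eq_zero_of_pair hij ?_ fun k hi hj => ?_
  · simp only [collide_apply, if_true, hij.symm, if_false, Real.cos_neg, Real.sin_neg]
    ring
  · simp only [collide_apply, hi, hj, if_false]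
    ring

theorem norm_collide {i j : Fin n} (hij : i ≠ j) (θ : ℝ) (v : Vel n) :
    ‖collide i j θ v‖ = ‖v‖ := by
  rw [← sq_eq_sq₀ (norm_nonneg _) (norm_nonneg _), EuclideanSpace.real_norm_sq_eq,
    EuclideanSpace.real_norm_sq_eq, ← sub_eq_zero, ← Finset.sum_sub_distrib]
  refine sum_eq_zero_of_pair hij ?_ fun k hi hj => ?_
  · simp only [collide_apply, if_true, hij.symm, if_false]
    linear_combination (v i ^ 2 + v j ^ 2) * Real.sin_sq_add_cos_sq θ
  · simp only [collide_apply, hi, hj, if_false, sub_self]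

/-- The uniform law of the scattering angle. -/
def angleLaw : Measure ℝ := cond (volume : Measure ℝ) (Set.Icc 0 (2 * Real.pi))

instance isProbabilityMeasure_angleLaw : IsProbabilityMeasure angleLaw :=
  cond_isProbabilityMeasure_of_finite (by simp [Real.pi_pos])
    (by rw [Real.volume_Icc]; exact ENNReal.ofReal_ne_top)

instance isProbabilityMeasure_kacPair (i j : Fin n) (μ : Measure (Vel n))
    [IsProbabilityMeasure μ] : IsProbabilityMeasure (kacPair i j μ) :=
  Measure.isProbabilityMeasure_map (μ := μ.prod angleLaw)
    (continuous_collide i j).measurable.aemeasurable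

theorem integrable_exp_collide (i j : Fin n) (μ : Measure (Vel n)) [IsFiniteMeasure μ]
    (ξ : Vel n) : Integrable (fun p : Vel n × ℝ => Complex.exp (-(2 * Real.pi *
      (inner ℝ ξ (collide i j p.2 p.1) : ℝ) : ℂ) * Complex.I)) (μ.prod angleLaw) := by
  have h1 : Continuous fun p : Vel n × ℝ => inner ℝ ξ (collide i j p.2 p.1) :=
    continuous_const.inner (continuous_collide i j)
  have h2 : Continuous fun x : ℝ => Complex.exp (-(2 * Real.pi * (x : ℝ) : ℂ) * Complex.I) := by
    fun_prop
  exact (integrable_const (1 : ℝ)).mono' (h2.comp h1).aestronglyMeasurable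
    (Filter.Eventually.of_forall fun p => (norm_exp_neg_mul_I _).le)

theorem integral_exp_collide {i j : Fin n} (hij : i ≠ j) (μ : Measure (Vel n)) (ξ : Vel n)
    (θ : ℝ) : ∫ v, Complex.exp (-(2 * Real.pi * (inner ℝ ξ (collide i j θ v) : ℝ) : ℂ) *
      Complex.I) ∂μ = measureFourier μ (collide i j (-θ) ξ) := by
  simp only [measureFourier, inner_collide hij]

theorem integrable_measureFourier_collide {i j : Fin n} (hij : i ≠ j) (μ : Measure (Vel n))
    [IsFiniteMeasure μ] (ξ : Vel n) :
    Integrable (fun θ => measureFourier μ (collide i j (-θ) ξ)) angleLaw := by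
  simpa only [integral_exp_collide hij] using (integrable_exp_collide i j μ ξ).integral_prod_right

theorem measureFourier_kacPair {i j : Fin n} (hij : i ≠ j) (μ : Measure (Vel n))
    [IsFiniteMeasure μ] (ξ : Vel n) : measureFourier (kacPair i j μ) ξ =
      ∫ θ, measureFourier μ (collide i j (-θ) ξ) ∂angleLaw := by
  rw [measureFourier, kacPair, integral_map (continuous_collide i j).measurable.aemeasurable
    (by fun_prop)]
  refine (integral_prod_symm _ (integrable_exp_collide i j μ ξ)).trans ?_
  simp only [integral_exp_collide hij]

theorem norm_measureFourier_kacPair_sub_le {i j : Fin n} (hij : i ≠ j) {μ : Measure (Vel n)}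
    [IsFiniteMeasure μ] {ξ : Vel n} {F : ℂ} {b : ℝ}
    (h : ∀ θ, ‖measureFourier μ (collide i j θ ξ) - F‖ ≤ b) :
    ‖measureFourier (kacPair i j μ) ξ - F‖ ≤ b := by
  have h1 : measureFourier (kacPair i j μ) ξ - F =
      ∫ θ, (measureFourier μ (collide i j (-θ) ξ) - F) ∂angleLaw := by
    rw [integral_sub (integrable_measureFourier_collide hij μ ξ) (integrable_const _),
      measureFourier_kacPair hij]
    simp
  rw [h1]
  simpa using norm_integral_le_of_norm_le_const (μ := angleLaw)
    (Filter.Eventually.of_forall fun θ => h (-θ))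

theorem card_filter_lt (n : ℕ) :
    (Finset.univ.filter (fun p : Fin n × Fin n => p.1 < p.2)).card = n.choose 2 := by
  rw [Finset.card_filter, Fintype.sum_prod_type_right]
  simp only [← Finset.card_filter]
  rw [Nat.choose_two_right, ← Finset.sum_range_id, ← Fin.sum_univ_eq_sum_range]
  refine Finset.sum_congr rfl fun j _ => ?_
  rw [show (Finset.univ.filter fun i : Fin n => i < j) = Finset.Iio j by ext; simp, Fin.card_Iio]

theorem choose_two_pos (hn : 2 ≤ n) : 0 < n.choose 2 := Nat.choose_pos hn

theorem isProbabilityMeasure_kacQ (hn : 2 ≤ n) (μ : Measure (Vel n))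
    [IsProbabilityMeasure μ] : IsProbabilityMeasure (kacQ μ) := by
  refine ⟨?_⟩
  have h0 : ((n.choose 2 : ℕ) : ℝ≥0∞) ≠ 0 := by exact_mod_cast (choose_two_pos hn).ne'
  simp [kacQ, card_filter_lt, ENNReal.inv_mul_cancel h0]

theorem isProbabilityMeasure_kacQ_iterate (hn : 2 ≤ n) (μ : Measure (Vel n))
    [h : IsProbabilityMeasure μ] (k : ℕ) : IsProbabilityMeasure (kacQ^[k] μ) := by
  induction k with
  | zero => exact h
  | succ k ih =>
    rw [Function.iterate_succ_apply']
    exact isProbabilityMeasure_kacQ hn _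

theorem measureFourier_kacQ (μ : Measure (Vel n)) [IsProbabilityMeasure μ] (ξ : Vel n) :
    measureFourier (kacQ μ) ξ = ((n.choose 2 : ℕ) : ℝ)⁻¹ •
      ∑ p ∈ Finset.univ.filter (fun p : Fin n × Fin n => p.1 < p.2),
        measureFourier (kacPair p.1 p.2 μ) ξ := by
  rw [measureFourier, kacQ, integral_smul_measure, integral_finsetSum_measure]
  · simp [measureFourier]
  · exact fun p _ => (integrable_const (1 : ℝ)).mono' (by fun_prop)
      (Filter.Eventually.of_forall fun v => (norm_exp_neg_mul_I _).le)

/-- The bound may depend on the pair, so that pairs which enlarge the support of `ξ` can be counted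
separately. -/
theorem norm_measureFourier_kacQ_sub_le (hn : 2 ≤ n) {μ : Measure (Vel n)}
    [IsProbabilityMeasure μ] {ξ : Vel n} {F : ℂ} {b : Fin n → Fin n → ℝ}
    (h : ∀ i j, i < j → ∀ θ, ‖measureFourier μ (collide i j θ ξ) - F‖ ≤ b i j) :
    ‖measureFourier (kacQ μ) ξ - F‖ ≤ ((n.choose 2 : ℕ) : ℝ)⁻¹ *
      ∑ p ∈ Finset.univ.filter (fun p : Fin n × Fin n => p.1 < p.2), b p.1 p.2 := by
  have h0 : ((n.choose 2 : ℕ) : ℝ) ≠ 0 := by exact_mod_cast (choose_two_pos hn).ne'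
  have h1 : measureFourier (kacQ μ) ξ - F = ((n.choose 2 : ℕ) : ℝ)⁻¹ •
      ∑ p ∈ Finset.univ.filter (fun p : Fin n × Fin n => p.1 < p.2),
        (measureFourier (kacPair p.1 p.2 μ) ξ - F) := by
    rw [measureFourier_kacQ, Finset.sum_sub_distrib, smul_sub, Finset.sum_const, card_filter_lt,
      ← Nat.cast_smul_eq_nsmul ℝ, inv_smul_smul₀ h0]
  rw [h1, norm_smul, Real.norm_eq_abs, abs_of_nonneg (by positivity)]
  gcongr
  refine (norm_sum_le _ _).trans (Finset.sum_le_sum fun p hp => ?_)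
  have hlt : p.1 < p.2 := (Finset.mem_filter.1 hp).2
  exact norm_measureFourier_kacPair_sub_le hlt.ne (h _ _ hlt)

theorem norm_measureFourier_kacQ_iterate_sub_le (hn : 2 ≤ n) {μ : Measure (Vel n)}
    [IsProbabilityMeasure μ] {r : ℝ} {F : ℂ} {b : ℝ}
    (h : ∀ ξ, ‖ξ‖ = r → ‖measureFourier μ ξ - F‖ ≤ b) (k : ℕ) {ξ : Vel n} (hξ : ‖ξ‖ = r) :
    ‖measureFourier (kacQ^[k] μ) ξ - F‖ ≤ b := by
  induction k generalizing ξ with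
  | zero => exact h ξ hξ
  | succ k ih =>
    have := isProbabilityMeasure_kacQ_iterate hn μ k
    have h0 : ((n.choose 2 : ℕ) : ℝ) ≠ 0 := by exact_mod_cast (choose_two_pos hn).ne'
    rw [Function.iterate_succ_apply']
    refine (norm_measureFourier_kacQ_sub_le hn (b := fun _ _ => b)
      fun i j hij θ => ih ((norm_collide hij.ne θ ξ).trans hξ)).trans (le_of_eq ?_)
    rw [Finset.sum_const, card_filter_lt, nsmul_eq_mul, inv_mul_cancel_left₀ h0]

/-- Listing the member in `S` first embeds the separated pairs into `S × Sᶜ`; the ordering `i < j`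
makes this injective. -/
theorem card_filter_separated_le (S : Finset (Fin n)) :
    ((Finset.univ.filter (fun p : Fin n × Fin n => p.1 < p.2)).filter
      fun p => ¬(p.1 ∈ S ↔ p.2 ∈ S)).card ≤ S.card * (n - S.card) := by
  have : (S ×ˢ Sᶜ).card = S.card * (n - S.card) := by
    rw [Finset.card_product, Finset.card_compl, Fintype.card_fin]
  rw [← this]
  refine Finset.card_le_card_of_injOn (fun p => if p.1 ∈ S then p else p.swap) ?_ ?_
  · intro p hp
    simp only [Finset.coe_filter, Finset.mem_filter, Finset.mem_univ, true_and,
      Set.mem_ofPred_eq] at hp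
    by_cases h : p.1 ∈ S <;> simp_all
  · intro p hp q hq hpq
    simp only [Finset.coe_filter, Finset.mem_filter, Finset.mem_univ, true_and,
      Set.mem_ofPred_eq] at hp hq
    obtain ⟨p1, p2⟩ := p
    obtain ⟨q1, q2⟩ := q
    by_cases h : p1 ∈ S <;> by_cases h' : q1 ∈ S <;>
      simp only [h, h', if_true, if_false, Prod.swap, Prod.mk.injEq] at hpq
    · simp [hpq]
    · obtain ⟨rfl, rfl⟩ := hpq
      exact absurd hp.1 (not_lt.2 hq.1.le)
    · obtain ⟨rfl, rfl⟩ := hpq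
      exact absurd hp.1 (not_lt.2 hq.1.le)
    · simp [hpq]

/-- The product of the probabilities that the next collision enlarges a set of particles of
cardinality `n - d`, `n - d + 1`, ..., `n - 1`. -/
def growthWeight (n d : ℕ) : ℝ :=
  ∏ l ∈ Finset.range d, ((l + 1 : ℕ) * (n - (l + 1 : ℕ)) / (n.choose 2 : ℕ) : ℝ)

theorem growthWeight_nonneg {d : ℕ} (hd : d ≤ n) : 0 ≤ growthWeight n d := by
  refine Finset.prod_nonneg fun l hl => ?_
  have : ((l + 1 : ℕ) : ℝ) ≤ n := by
    exact_mod_cast (Nat.succ_le_of_lt (Finset.mem_range.1 hl)).trans hd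
  have := sub_nonneg.2 this
  positivity

/-- Here `d` counts the particles outside a set `S` carrying `ξ`. A collision changes `S` only if it
separates the pair, and then one particle joins. Until `d` such collisions have occurred some
coordinate is zero and the deviation from `F` vanishes. The binomial coefficient counts their
possible positions among the `k` collisions, and `growthWeight` bounds the probability of each
choice. -/
theorem norm_measureFourier_kacQ_iterate_sub_le_choose (hn : 2 ≤ n) {μ : Measure (Vel n)}
    [IsProbabilityMeasure μ] {r : ℝ} {F : ℂ} {A : ℝ} (hA : 0 ≤ A)
    (h : ∀ ξ, ‖ξ‖ = r → ‖measureFourier μ ξ - F‖ ≤ A)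
    (h0 : ∀ ξ, ‖ξ‖ = r → (∃ i, ξ i = 0) → measureFourier μ ξ = F)
    (k d : ℕ) {S : Finset (Fin n)} (hS : S.card + d = n) {ξ : Vel n} (hξ : ‖ξ‖ = r)
    (hsupp : ∀ i, i ∉ S → ξ i = 0) :
    ‖measureFourier (kacQ^[k] μ) ξ - F‖ ≤ A * (k.choose d * growthWeight n d) := by
  have hN : ((n.choose 2 : ℕ) : ℝ) ≠ 0 := by exact_mod_cast (choose_two_pos hn).ne'
  induction k generalizing d S ξ with
  | zero =>
    rcases d with _ | d
    · simpa [growthWeight] using h ξ hξ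
    · obtain ⟨i, hi⟩ : ∃ i, i ∉ S := by
        by_contra! hc
        have : S = Finset.univ := Finset.eq_univ_iff_forall.2 hc
        rw [this, Finset.card_univ, Fintype.card_fin] at hS
        omega
      rw [Function.iterate_zero_apply, h0 ξ hξ ⟨i, hsupp i hi⟩]
      simp
  | succ k ih =>
    rcases d with _ | d
    · simpa [growthWeight] using norm_measureFourier_kacQ_iterate_sub_le hn h (k + 1) hξ
    have := isProbabilityMeasure_kacQ_iterate hn μ k
    rw [Function.iterate_succ_apply']
    have hw1 := growthWeight_nonneg (n := n) (d := d + 1) (by omega)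
    have hw0 := growthWeight_nonneg (n := n) (d := d) (by omega)
    set b1 := A * (k.choose (d + 1) * growthWeight n (d + 1)) with hb1
    set b0 := A * (k.choose d * growthWeight n d) with hb0
    -- For a separated pair `b0` alone suffices; charging `b1` to every pair makes the average match
    -- Pascal's rule.
    refine (norm_measureFourier_kacQ_sub_le hn
      (b := fun i j => b1 + if ¬(i ∈ S ↔ j ∈ S) then b0 else 0)
      fun i j hij θ => ?_).trans ?_
    · have hnorm := (norm_collide hij.ne θ ξ).trans hξ
      have hb1' : 0 ≤ b1 := by positivity
      have hb0' : 0 ≤ b0 := by positivity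
      by_cases hi : i ∈ S <;> by_cases hj : j ∈ S
      · simp only [hi, hj, iff_self, not_true, if_false, add_zero]
        refine ih (d + 1) hS hnorm fun l hl => ?_
        have h1 : l ≠ i := fun e => hl (e ▸ hi)
        have h2 : l ≠ j := fun e => hl (e ▸ hj)
        simp [collide_apply, h1, h2, hsupp l hl]
      · have key := ih d (S := insert j S) (by rw [Finset.card_insert_of_notMem hj]; omega) hnorm
          fun l hl => by
            rw [Finset.mem_insert, not_or] at hl
            have h1 : l ≠ i := fun e => hl.2 (e ▸ hi)
            simp [collide_apply, h1, hl.1, hsupp l hl.2]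
        simp only [hi, hj, iff_false, not_true, not_false_eq_true, if_true]
        linarith
      · have key := ih d (S := insert i S) (by rw [Finset.card_insert_of_notMem hi]; omega) hnorm
          fun l hl => by
            rw [Finset.mem_insert, not_or] at hl
            have h1 : l ≠ j := fun e => hl.2 (e ▸ hj)
            simp [collide_apply, h1, hl.1, hsupp l hl.2]
        simp only [hi, hj, iff_true, not_false_eq_true, if_true]
        linarith
      · simp only [hi, hj, iff_self, not_true, if_false, add_zero]
        refine ih (d + 1) hS hnorm fun l hl => ?_
        rw [collide_apply]
        split_ifs
        · simp [hsupp i hi, hsupp j hj]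
        · simp [hsupp i hi, hsupp j hj]
        · exact hsupp l hl
    · rw [Finset.sum_add_distrib, Finset.sum_const, card_filter_lt, nsmul_eq_mul,
        ← Finset.sum_filter, Finset.sum_const, nsmul_eq_mul, mul_add, inv_mul_cancel_left₀ hN]
      have hcard : ((((Finset.univ.filter (fun p : Fin n × Fin n => p.1 < p.2)).filter
          fun p => ¬(p.1 ∈ S ↔ p.2 ∈ S)).card : ℕ) : ℝ) ≤ (d + 1 : ℕ) * (n - (d + 1 : ℕ)) := by
        have h1 : n - S.card = d + 1 := by omega
        have h2 : (S.card : ℝ) = n - (d + 1 : ℕ) := by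
          rw [eq_sub_iff_add_eq]; exact_mod_cast hS
        have := card_filter_separated_le S
        rw [h1] at this
        rw [← h2, mul_comm]
        exact_mod_cast this
      have hwsucc : growthWeight n (d + 1) = growthWeight n d *
          ((d + 1 : ℕ) * (n - (d + 1 : ℕ)) / (n.choose 2 : ℕ)) := Finset.prod_range_succ _ _
      have : A * ((k + 1).choose (d + 1) * growthWeight n (d + 1)) = b1 +
          ((n.choose 2 : ℕ) : ℝ)⁻¹ * (((d + 1 : ℕ) * (n - (d + 1 : ℕ))) * b0) := by
        rw [hb1, hb0, Nat.choose_succ_succ, hwsucc]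
        push_cast
        ring
      rw [this]
      gcongr

end Collision

/-! ### Poisson averaging and the size of the growth weight -/

section Evolution

variable {n : ℕ}

theorem hasSum_poisson (x : ℝ) :
    HasSum (fun k : ℕ => Real.exp (-x) * x ^ k / (k.factorial : ℝ)) 1 := by
  have := (NormedSpace.expSeries_div_hasSum_exp (𝔸 := ℝ) x).mul_left (Real.exp (-x))
  rw [← Real.exp_eq_exp_ℝ, ← Real.exp_add, neg_add_cancel, Real.exp_zero] at this
  simpa only [mul_div_assoc] using this

/-- This is a factorial moment of the Poisson law: after the shift `k ↦ k + d`, `C(k+d, d)/(k+d)! =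
1/(k! d!)`. -/
theorem hasSum_poisson_mul_choose (x : ℝ) (d : ℕ) :
    HasSum (fun k : ℕ => Real.exp (-x) * x ^ k / (k.factorial : ℝ) * k.choose d)
      (x ^ d / d.factorial) := by
  rw [← (add_left_injective d).hasSum_iff fun k hk => ?_]
  · have := (hasSum_poisson x).mul_left (x ^ d / d.factorial)
    rw [mul_one] at this
    convert! this using 2 with k
    simp only [Function.comp_apply]
    have h1 : ((k + d).factorial : ℝ) = (k + d).choose d * k.factorial * d.factorial := by
      have := Nat.add_choose_mul_factorial_mul_factorial k d
      exact_mod_cast this.symm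
    have h2 : ((k + d).choose d : ℝ) ≠ 0 := by
      exact_mod_cast (Nat.choose_pos (Nat.le_add_left d k)).ne'
    rw [h1, pow_add]
    field_simp
  · have : k < d := by
      by_contra! h
      exact hk ⟨k - d, Nat.sub_add_cancel h⟩
    simp [Nat.choose_eq_zero_of_lt this]

theorem isProbabilityMeasure_kacEvolution (hn : 2 ≤ n) (μ : Measure (Vel n))
    [IsProbabilityMeasure μ] {t : ℝ} (ht : 0 ≤ t) : IsProbabilityMeasure (kacEvolution t μ) := by
  refine ⟨?_⟩
  have (k : ℕ) := isProbabilityMeasure_kacQ_iterate hn μ k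
  rw [kacEvolution, Measure.sum_apply _ MeasurableSet.univ]
  simp only [Measure.smul_apply, measure_univ, smul_eq_mul, mul_one]
  rw [← ENNReal.ofReal_tsum_of_nonneg (fun k => by positivity) (hasSum_poisson _).summable,
    (hasSum_poisson _).tsum_eq, ENNReal.ofReal_one]

theorem norm_measureFourier_kacEvolution_sub_le (hn : 2 ≤ n) {μ : Measure (Vel n)}
    [IsProbabilityMeasure μ] {t : ℝ} (ht : 0 ≤ t) {ξ : Vel n} {F : ℂ} {b : ℕ → ℝ} {s : ℝ}
    (h : ∀ k, ‖measureFourier (kacQ^[k] μ) ξ - F‖ ≤ b k)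
    (hb : HasSum (fun k : ℕ => Real.exp (-(n * t)) * (n * t) ^ k / (k.factorial : ℝ) * b k) s) :
    ‖measureFourier (kacEvolution t μ) ξ - F‖ ≤ s := by
  have := isProbabilityMeasure_kacEvolution hn μ ht
  have hint : Integrable (fun v : Vel n => Complex.exp (-(2 * Real.pi * (inner ℝ ξ v : ℝ) : ℂ) *
      Complex.I)) (kacEvolution t μ) :=
    (integrable_const (1 : ℝ)).mono' (by fun_prop)
      (Filter.Eventually.of_forall fun v => (norm_exp_neg_mul_I _).le)
  have hsum := hasSum_integral_measure hint
  have h1 : ∀ k : ℕ, ∫ v : Vel n, Complex.exp (-(2 * Real.pi * (inner ℝ ξ v : ℝ) : ℂ) *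
      Complex.I) ∂(ENNReal.ofReal (Real.exp (-(n * t)) * (n * t) ^ k / (k.factorial : ℝ)) •
        (kacQ^[k] μ)) = (Real.exp (-(n * t)) * (n * t) ^ k / (k.factorial : ℝ)) •
          measureFourier (kacQ^[k] μ) ξ := fun k => by
    rw [integral_smul_measure, ENNReal.toReal_ofReal (by positivity)]
    rfl
  simp only [h1] at hsum
  have hF := (hasSum_poisson (n * t)).smul_const F
  rw [one_smul] at hF
  refine (hsum.sub hF).norm_le_of_bounded hb fun k => ?_
  rw [← smul_sub, norm_smul, Real.norm_eq_abs, abs_of_nonneg (by positivity)]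
  exact mul_le_mul_of_nonneg_left (h k) (by positivity)

theorem norm_measureFourier_kacEvolution_sub_le_of_forall (hn : 2 ≤ n) {μ : Measure (Vel n)}
    [IsProbabilityMeasure μ] {t : ℝ} (ht : 0 ≤ t) {r : ℝ} {F : ℂ} {b : ℝ}
    (h : ∀ ξ, ‖ξ‖ = r → ‖measureFourier μ ξ - F‖ ≤ b) {ξ : Vel n} (hξ : ‖ξ‖ = r) :
    ‖measureFourier (kacEvolution t μ) ξ - F‖ ≤ b := by
  refine norm_measureFourier_kacEvolution_sub_le hn ht (b := fun _ => b)
    (fun k => norm_measureFourier_kacQ_iterate_sub_le hn h k hξ) ?_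
  simpa using (hasSum_poisson (n * t)).mul_right b

/-- The transform of the angular average is constant on each sphere, and the evolution averages the
transform of `μ` within that sphere, so a bound on the sphere survives. -/
theorem gtwDist_kacEvolution_angularAverage_le (hn : 2 ≤ n) (μ : Measure (Vel n))
    [IsProbabilityMeasure μ] {t : ℝ} (ht : 0 ≤ t) :
    gtwDist (kacEvolution t μ) (angularAverage μ) ≤ gtwDist μ (angularAverage μ) := by
  have : NeZero n := ⟨by omega⟩
  refine iSup₂_le fun ξ hξ => ?_
  have hpos : 0 < ‖ξ‖ ^ 2 := by positivity
  by_cases htop : gtwDist μ (angularAverage μ) = ∞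
  · rw [htop]; exact le_top
  refine (ENNReal.ofReal_le_ofReal (q := (gtwDist μ (angularAverage μ)).toReal) ?_).trans
    (ENNReal.ofReal_toReal htop).le
  rw [div_le_iff₀ hpos]
  refine norm_measureFourier_kacEvolution_sub_le_of_forall hn ht (fun η hη => ?_) rfl
  have hη0 : η ≠ 0 := norm_ne_zero_iff.1 (hη ▸ norm_ne_zero_iff.2 hξ)
  rw [← measureFourier_angularAverage_eq_of_norm_eq μ hη, ← hη, ← div_le_iff₀ (by positivity)]
  refine (ENNReal.ofReal_le_iff_le_toReal htop).1 ?_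
  exact le_iSup₂ (f := fun (ξ : Vel n) (_ : ξ ≠ 0) => ENNReal.ofReal
    (‖measureFourier μ ξ - measureFourier (angularAverage μ) ξ‖ / ‖ξ‖ ^ 2)) η hη0

/-- Both `∏ l` and `∏ (n - l)` over `1 ≤ l ≤ n - 1` equal `(n-1)!`, and `n / C(n,2) = 2/(n-1)`. -/
theorem growthWeight_pred (hn : 2 ≤ n) : growthWeight n (n - 1) * n ^ (n - 1) =
    ((n - 1).factorial : ℝ) ^ 2 * (2 / (n - 1 : ℕ)) ^ (n - 1) := by
  obtain ⟨m, rfl⟩ : ∃ m, n = m + 2 := ⟨n - 2, by omega⟩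
  have h1 : ∏ l ∈ Finset.range (m + 1), ((l + 1 : ℕ) : ℝ) = (m + 1).factorial := by
    exact_mod_cast Finset.prod_range_add_one_eq_factorial (m + 1)
  have h2 : ∏ l ∈ Finset.range (m + 1), (((m + 2 : ℕ) : ℝ) - (l + 1 : ℕ)) =
      (m + 1).factorial := by
    rw [← h1, ← Finset.prod_range_reflect]
    refine Finset.prod_congr rfl fun l hl => ?_
    have : l < m + 1 := Finset.mem_range.1 hl
    have h3 : m + 1 - 1 - l + 1 + (l + 1) = m + 2 := by omega
    rw [sub_eq_iff_eq_add]
    have h4 : m + 2 = l + 1 + (m + 1 - 1 - l + 1) := by omega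
    exact_mod_cast h4
  have h3 : (((m + 2).choose 2 : ℕ) : ℝ) = (m + 2) * (m + 1) / 2 := by
    rw [Nat.cast_choose_two]
    push_cast
    ring
  rw [growthWeight, show m + 2 - 1 = m + 1 by omega, Finset.prod_div_distrib,
    Finset.prod_mul_distrib, h1, h2, Finset.prod_const, Finset.card_range, h3, ← sq,
    div_mul_eq_mul_div, mul_div_assoc, ← div_pow]
  congr 2
  push_cast
  field_simp

/-- With `n = m + 2` this is `(n-1)!/(n-1)^{n-1} ≤ 2/n`. The induction uses `(m+3)(m+1) ≤ (m+2)²`.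
-/
theorem factorial_le_two_mul_pow (m : ℕ) : (m + 2).factorial ≤ 2 * (m + 1) ^ (m + 1) := by
  induction m with
  | zero => decide
  | succ m ih =>
    rw [Nat.factorial_succ]
    calc (m + 2 + 1) * (m + 2).factorial ≤ (m + 2 + 1) * (2 * (m + 1) ^ (m + 1)) := by gcongr
      _ = 2 * ((m + 3) * (m + 1)) * (m + 1) ^ m := by ring
      _ ≤ 2 * ((m + 2) ^ 2) * (m + 2) ^ m := by
        gcongr
        · nlinarith
        · omega
      _ = _ := by ring

theorem growthWeight_mul_pow_div_factorial_le (hn : 2 ≤ n) {t : ℝ} (ht : 0 ≤ t) :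
    (n * t) ^ (n - 1) / (n - 1).factorial * growthWeight n (n - 1) ≤
      2 / n * (2 * t) ^ (n - 1) := by
  have h1 : (n * t) ^ (n - 1) / (n - 1).factorial * growthWeight n (n - 1) =
      ((n - 1).factorial / ((n - 1 : ℕ) : ℝ) ^ (n - 1)) * (2 * t) ^ (n - 1) := by
    have := growthWeight_pred hn
    rw [div_pow] at this
    have hf : ((n - 1).factorial : ℝ) ≠ 0 := by positivity
    rw [mul_pow, mul_pow]
    calc _ = t ^ (n - 1) / (n - 1).factorial * (growthWeight n (n - 1) * n ^ (n - 1)) := by ring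
      _ = _ := by
        rw [this]
        field_simp
  rw [h1]
  refine mul_le_mul_of_nonneg_right ?_ (by positivity)
  obtain ⟨m, rfl⟩ : ∃ m, n = m + 2 := ⟨n - 2, by omega⟩
  rw [show m + 2 - 1 = m + 1 by omega, div_le_div_iff₀ (by positivity) (by positivity)]
  have := factorial_le_two_mul_pow m
  rw [Nat.factorial_succ, mul_comm] at this
  exact_mod_cast this

end Evolution

/-! ### Lower bounds for the distance along the evolution -/

section SlowDecay

variable {n : ℕ}

theorem sq_mul_exp_neg_sq_le (r : ℝ) : r ^ 2 * Real.exp (-r ^ 2) ≤ Real.exp (-1) := by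
  have h := Real.add_one_le_exp (r ^ 2 - 1)
  rw [sub_add_cancel] at h
  calc r ^ 2 * Real.exp (-r ^ 2) ≤ Real.exp (r ^ 2 - 1) * Real.exp (-r ^ 2) := by gcongr
    _ = Real.exp (-1) := by rw [← Real.exp_add]; congr 1; ring

theorem le_gtwDist (μ ν : Measure (Vel n)) {ξ : Vel n} (hξ : ξ ≠ 0) :
    ENNReal.ofReal (‖measureFourier μ ξ - measureFourier ν ξ‖ / ‖ξ‖ ^ 2) ≤ gtwDist μ ν :=
  le_iSup₂ (f := fun (ξ : Vel n) (_ : ξ ≠ 0) => ENNReal.ofReal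
    (‖measureFourier μ ξ - measureFourier ν ξ‖ / ‖ξ‖ ^ 2)) ξ hξ

theorem hasDerivWithinAt_zero_of_abs_sub_le {F : ℝ → ℝ} {K : ℝ} {m : ℕ} (hm : 2 ≤ m)
    (h : ∀ t, 0 ≤ t → |F t - F 0| ≤ K * t ^ m) : HasDerivWithinAt F 0 (Set.Ici 0) 0 := by
  rw [hasDerivWithinAt_iff_isLittleO]
  simp only [smul_zero, sub_zero]
  have h1 : (fun t : ℝ => F t - F 0) =O[nhdsWithin 0 (Set.Ici 0)] fun t : ℝ => t ^ m := by
    refine Asymptotics.IsBigO.of_bound K ?_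
    filter_upwards [self_mem_nhdsWithin] with t ht
    have ht0 : 0 ≤ t := ht
    rw [Real.norm_eq_abs, Real.norm_eq_abs, abs_of_nonneg (pow_nonneg ht0 m)]
    exact h t ht0
  exact h1.trans_isLittleO
    ((Asymptotics.isLittleO_pow_id (by omega)).mono nhdsWithin_le_nhds)

/-- The Fourier transform of `μ` is radial up to the perturbation
`B⁻¹ |ξ|⁴ e^{-|ξ|²} ∏_i (1 - e^{-α ξ_i²})`. -/
def HasSlowFourier (μ : Measure (Vel n)) (α B : ℝ) (g : ℝ → ℝ) : Prop :=
  ∀ ξ, measureFourier μ ξ =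
    ((g ‖ξ‖ + 1 / B * (‖ξ‖ ^ 4 * Real.exp (-‖ξ‖ ^ 2) * coordFactor α ξ) : ℝ) : ℂ)

variable {μ : Measure (Vel n)} {α B : ℝ} {g : ℝ → ℝ}

theorem HasSlowFourier.angularAverage [NeZero n] [IsProbabilityMeasure μ]
    (hF : HasSlowFourier μ α B g) (hα : 0 ≤ α) (ξ : Vel n) :
    measureFourier (angularAverage μ) ξ =
      ((g ‖ξ‖ + 1 / B * (‖ξ‖ ^ 4 * Real.exp (-‖ξ‖ ^ 2) * coordMean n α ‖ξ‖) : ℝ) : ℂ) := by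
  rw [measureFourier_angularAverage]
  have h1 : (fun ω => measureFourier μ (‖ξ‖ • ω)) =ᵐ[unitSphereLaw n] fun ω =>
      ((g ‖ξ‖ + 1 / B * (‖ξ‖ ^ 4 * Real.exp (-‖ξ‖ ^ 2)) * coordFactor α (‖ξ‖ • ω) : ℝ) : ℂ) := by
    filter_upwards [ae_unitSphereLaw_norm_eq_one] with ω hω
    rw [hF, norm_smul, hω, norm_norm, mul_one, mul_assoc (1 / B)]
  rw [integral_congr_ae h1, integral_complex_ofReal, integral_add (integrable_const _)
    ((integrable_coordFactor hα _).const_mul _), integral_const_mul]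
  simp only [integral_const, probReal_univ, one_smul, coordMean, mul_assoc]

/-- The radial part cancels, and `|ξ|⁴` leaves the weight `|ξ|² e^{-|ξ|²}`, which is bounded and
maximal at `|ξ| = 1`. -/
theorem HasSlowFourier.ratio_eq [NeZero n] [IsProbabilityMeasure μ]
    (hF : HasSlowFourier μ α B g) (hα : 0 ≤ α) (hB : 0 < B) {ξ : Vel n} (hξ : ξ ≠ 0) :
    ‖measureFourier μ ξ - measureFourier (_root_.angularAverage μ) ξ‖ / ‖ξ‖ ^ 2 =
      1 / B * (‖ξ‖ ^ 2 * Real.exp (-‖ξ‖ ^ 2) * |coordFactor α ξ - coordMean n α ‖ξ‖|) := by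
  have hpos : 0 < ‖ξ‖ ^ 2 := by positivity
  rw [hF.angularAverage hα, hF ξ, ← Complex.ofReal_sub, Complex.norm_real, Real.norm_eq_abs,
    add_sub_add_left_eq_sub, ← mul_sub, ← mul_sub, abs_mul, abs_mul,
    abs_of_nonneg (show 0 ≤ 1 / B by positivity),
    abs_of_nonneg (show 0 ≤ ‖ξ‖ ^ 4 * Real.exp (-‖ξ‖ ^ 2) by positivity)]
  field_simp

theorem abs_coordFactor_sub_coordMean_le_one [NeZero n] (hα : 0 ≤ α) (ξ : Vel n) (r : ℝ) :
    |coordFactor α ξ - coordMean n α r| ≤ 1 := by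
  rw [abs_le]
  constructor <;> linarith [coordFactor_nonneg hα ξ, coordFactor_le_one hα ξ,
    coordMean_nonneg (n := n) hα r, coordMean_le_one (n := n) hα r]

theorem HasSlowFourier.gtwDist_lt_top [NeZero n] [IsProbabilityMeasure μ]
    (hF : HasSlowFourier μ α B g) (hα : 0 ≤ α) (hB : 0 < B) :
    gtwDist μ (_root_.angularAverage μ) < ∞ := by
  refine lt_of_le_of_lt (iSup₂_le fun ξ hξ => ?_)
    (ENNReal.ofReal_lt_top (r := 1 / B * (Real.exp (-1) * 1)))
  rw [hF.ratio_eq hα hB hξ]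
  refine ENNReal.ofReal_le_ofReal ?_
  gcongr
  · exact sq_mul_exp_neg_sq_le _
  · exact abs_coordFactor_sub_coordMean_le_one hα ξ _

theorem exists_axis_vector (hn : 2 ≤ n) {r : ℝ} (hr : 0 < r) :
    ∃ (i : Fin n) (ξ : Vel n), ‖ξ‖ = r ∧ ξ ≠ 0 ∧ (∀ j, j ∉ ({i} : Finset (Fin n)) → ξ j = 0) ∧
      ∃ j, ξ j = 0 := by
  refine ⟨⟨0, by omega⟩, EuclideanSpace.single ⟨0, by omega⟩ r, ?_, ?_, fun j hj => ?_,
    ⟨1, by omega⟩, ?_⟩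
  · simp [abs_of_pos hr]
  · simp [hr.ne']
  · rw [Finset.mem_singleton] at hj
    simp [hj]
  · simp

/-- Tested at a unit axis vector: the factor vanishes and the weight attains its maximum `e⁻¹`. -/
theorem HasSlowFourier.le_gtwDist (hn : 2 ≤ n) [IsProbabilityMeasure μ]
    (hF : HasSlowFourier μ α B g) (hα : 0 ≤ α) (hB : 0 < B) {β : ℝ} (hβ : β ≤ coordMean n α 1) :
    ENNReal.ofReal (1 / B * (Real.exp (-1) * β)) ≤ gtwDist μ (_root_.angularAverage μ) := by
  have : NeZero n := ⟨by omega⟩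
  obtain ⟨i, ξ, hnorm, hξ, -, j, hj⟩ := exists_axis_vector hn one_pos
  refine le_trans (ENNReal.ofReal_le_ofReal ?_) (_root_.le_gtwDist _ _ hξ)
  rw [hF.ratio_eq hα hB hξ, hnorm, coordFactor_eq_zero α hj, zero_sub, abs_neg,
    abs_of_nonneg (coordMean_nonneg hα _), one_pow, one_mul]
  gcongr

theorem HasSlowFourier.norm_kacEvolution_sub_le (hn : 2 ≤ n) [IsProbabilityMeasure μ]
    (hF : HasSlowFourier μ α B g) (hα : 0 ≤ α) (hB : 0 < B) {t : ℝ} (ht : 0 ≤ t)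
    {i : Fin n} {ξ : Vel n} (hsupp : ∀ j, j ∉ ({i} : Finset (Fin n)) → ξ j = 0) :
    ‖measureFourier (kacEvolution t μ) ξ - (g ‖ξ‖ : ℂ)‖ ≤
      1 / B * (‖ξ‖ ^ 4 * Real.exp (-‖ξ‖ ^ 2)) * (2 / n * (2 * t) ^ (n - 1)) := by
  set A := 1 / B * (‖ξ‖ ^ 4 * Real.exp (-‖ξ‖ ^ 2)) with hA
  have hA0 : 0 ≤ A := by positivity
  have hk : ∀ k, ‖measureFourier (kacQ^[k] μ) ξ - (g ‖ξ‖ : ℂ)‖ ≤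
      A * (k.choose (n - 1) * growthWeight n (n - 1)) := fun k => by
    refine norm_measureFourier_kacQ_iterate_sub_le_choose hn hA0 (r := ‖ξ‖) ?_ ?_ k (n - 1)
      (S := {i}) (by rw [Finset.card_singleton]; omega) rfl hsupp
    · intro η hη
      rw [hF η, hη, ← Complex.ofReal_sub, add_sub_cancel_left, Complex.norm_real,
        Real.norm_eq_abs, ← mul_assoc, abs_mul, ← hA, abs_of_nonneg hA0,
        abs_of_nonneg (coordFactor_nonneg hα η)]
      exact mul_le_of_le_one_right hA0 (coordFactor_le_one hα η)
    · rintro η hη ⟨j, hj⟩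
      rw [hF η, hη, coordFactor_eq_zero α hj, mul_zero, mul_zero, add_zero]
  refine (norm_measureFourier_kacEvolution_sub_le hn ht hk
    (s := A * ((n * t) ^ (n - 1) / (n - 1).factorial * growthWeight n (n - 1))) ?_).trans
    (mul_le_mul_of_nonneg_left (growthWeight_mul_pow_div_factorial_le hn ht) hA0)
  convert! ((hasSum_poisson_mul_choose (n * t) (n - 1)).mul_right
    (growthWeight n (n - 1))).mul_left A using 2 with k
  ring

/-- On an axis the evolved transform stays near the radial part `g`, while that of the angular
average differs from `g` by the full mean. The triangle inequality gives the claim. -/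
theorem HasSlowFourier.ofReal_le_gtwDist_kacEvolution_add (hn : 2 ≤ n) [IsProbabilityMeasure μ]
    (hF : HasSlowFourier μ α B g) (hα : 0 ≤ α) (hB : 0 < B) {t : ℝ} (ht : 0 ≤ t) {r : ℝ}
    (hr : 0 < r) :
    ENNReal.ofReal (1 / B * (r ^ 2 * Real.exp (-r ^ 2) * coordMean n α r)) ≤
      gtwDist (kacEvolution t μ) (_root_.angularAverage μ) +
        ENNReal.ofReal (1 / B * (Real.exp (-1) * (2 / n * (2 * t) ^ (n - 1)))) := by
  have : NeZero n := ⟨by omega⟩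
  obtain ⟨i, ξ, hnorm, hξ, hsupp, -⟩ := exists_axis_vector hn hr
  have h1 := hF.norm_kacEvolution_sub_le hn hα hB ht hsupp
  have h2 := norm_sub_norm_le ((g ‖ξ‖ : ℂ) - measureFourier (_root_.angularAverage μ) ξ)
    ((g ‖ξ‖ : ℂ) - measureFourier (kacEvolution t μ) ξ)
  rw [sub_sub_sub_cancel_left, norm_sub_rev _ (measureFourier (kacEvolution t μ) ξ)] at h2
  have h3 : ‖(g ‖ξ‖ : ℂ) - measureFourier (_root_.angularAverage μ) ξ‖ =
      1 / B * (r ^ 4 * Real.exp (-r ^ 2) * coordMean n α r) := by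
    have := coordMean_nonneg (n := n) hα r
    rw [hF.angularAverage hα, ← Complex.ofReal_sub, sub_add_cancel_left, Complex.norm_real,
      norm_neg, Real.norm_eq_abs, hnorm, abs_of_nonneg (by positivity)]
  rw [h3] at h2
  rw [hnorm] at h1 h2
  set q := 2 / n * (2 * t) ^ (n - 1) with hq
  have hq0 : 0 ≤ q := by positivity
  refine le_trans ?_ (add_le_add_left (_root_.le_gtwDist _ _ hξ) _)
  rw [← ENNReal.ofReal_add (by positivity) (by positivity), hnorm]
  refine ENNReal.ofReal_le_ofReal ?_
  have h4 : 1 / B * (r ^ 2 * Real.exp (-r ^ 2) * q) ≤ 1 / B * (Real.exp (-1) * q) := by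
    gcongr
    exact sq_mul_exp_neg_sq_le r
  have h5 : 1 / B * (r ^ 2 * Real.exp (-r ^ 2) * coordMean n α r) -
      1 / B * (r ^ 2 * Real.exp (-r ^ 2) * q) ≤
      ‖measureFourier (kacEvolution t μ) ξ - measureFourier (_root_.angularAverage μ) ξ‖ /
        r ^ 2 := by
    rw [le_div_iff₀ (by positivity)]
    calc _ = 1 / B * (r ^ 4 * Real.exp (-r ^ 2) * coordMean n α r) -
          1 / B * (r ^ 4 * Real.exp (-r ^ 2)) * q := by ring
      _ ≤ _ := by linarith
  linarith

/-- Every frequency is beaten by one on an axis. If `P ≤ m`, the axis point of the same radius does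
at least as well, since `m - P ≤ m`. If `P ≥ m`, the unit axis vector does. -/
theorem HasSlowFourier.gtwDist_le_kacEvolution_add (hn : 2 ≤ n) [IsProbabilityMeasure μ]
    (hF : HasSlowFourier μ α B g) (hα : 0 ≤ α) (hB : 0 < B)
    (hmean : ∀ r : ℝ, 1 / 6 ≤ r ^ 2 → 3 / 4 ≤ coordMean n α r) {t : ℝ} (ht : 0 ≤ t) :
    gtwDist μ (_root_.angularAverage μ) ≤
      gtwDist (kacEvolution t μ) (_root_.angularAverage μ) +
        ENNReal.ofReal (1 / B * (Real.exp (-1) * (2 / n * (2 * t) ^ (n - 1)))) := by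
  have : NeZero n := ⟨by omega⟩
  refine iSup₂_le fun ξ hξ => ?_
  have hr : 0 < ‖ξ‖ := norm_pos_iff.2 hξ
  rw [hF.ratio_eq hα hB hξ]
  have hP0 := coordFactor_nonneg hα ξ
  have hP1 := coordFactor_le_one hα ξ
  have hm0 := coordMean_nonneg (n := n) hα ‖ξ‖
  have hm1 := coordMean_le_one (n := n) hα ‖ξ‖
  rcases le_total (coordFactor α ξ) (coordMean n α ‖ξ‖) with h | h
  · refine le_trans (ENNReal.ofReal_le_ofReal ?_)
      (hF.ofReal_le_gtwDist_kacEvolution_add hn hα hB ht hr)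
    rw [abs_of_nonpos (sub_nonpos.2 h)]
    gcongr
    linarith
  · refine le_trans (ENNReal.ofReal_le_ofReal ?_)
      (hF.ofReal_le_gtwDist_kacEvolution_add hn hα hB ht one_pos)
    rw [abs_of_nonneg (sub_nonneg.2 h)]
    refine mul_le_mul_of_nonneg_left ?_ (by positivity)
    have hone := hmean 1 (by norm_num)
    have hexp : 1 / 3 ≤ Real.exp (-1) := by
      rw [Real.exp_neg, ← one_div]
      exact one_div_le_one_div_of_le (Real.exp_pos _) (by linarith [Real.exp_one_lt_d9])
    have hlow : 1 / 4 ≤ (1 : ℝ) ^ 2 * Real.exp (-1 ^ 2) * coordMean n α 1 := by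
      rw [one_pow, one_mul]
      nlinarith
    -- The unit axis vector contributes at least `(1/3)(3/4) = 1/4`. Beyond radius² `1/6` the defect
    -- `P - m` is at most `1/4`, and within it the weight is at most `1/6`.
    rcases le_total (1 / 6) (‖ξ‖ ^ 2) with h6 | h6
    · have hb := hmean _ h6
      calc ‖ξ‖ ^ 2 * Real.exp (-‖ξ‖ ^ 2) * (coordFactor α ξ - coordMean n α ‖ξ‖)
          ≤ Real.exp (-1) * (1 / 4) := by
            exact mul_le_mul (sq_mul_exp_neg_sq_le _) (by linarith) (by linarith)
              (Real.exp_pos _).le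
        _ ≤ Real.exp (-1) * coordMean n α 1 := by gcongr; linarith
        _ = _ := by rw [one_pow, one_mul]
    · refine le_trans ?_ hlow
      calc ‖ξ‖ ^ 2 * Real.exp (-‖ξ‖ ^ 2) * (coordFactor α ξ - coordMean n α ‖ξ‖)
          ≤ 1 / 6 * 1 * 1 := by
            have h1 : Real.exp (-‖ξ‖ ^ 2) ≤ 1 :=
              Real.exp_le_one_iff.2 (by linarith [sq_nonneg ‖ξ‖])
            exact mul_le_mul (mul_le_mul h6 h1 (Real.exp_pos _).le (by norm_num)) (by linarith)
              (by linarith) (by norm_num)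
        _ ≤ 1 / 4 := by norm_num

theorem HasSlowFourier.toReal_gtwDist_mul_le (hn : 2 ≤ n) [IsProbabilityMeasure μ]
    (hF : HasSlowFourier μ α B g) (hα : 0 ≤ α) (hB : 0 < B)
    (hmean : ∀ r : ℝ, 1 / 6 ≤ r ^ 2 → 3 / 4 ≤ coordMean n α r) {t : ℝ} (ht : 0 ≤ t) :
    (gtwDist μ (_root_.angularAverage μ)).toReal *
        (1 - Real.exp 1 / n * (2 * t) ^ (n - 1)) ≤
      (gtwDist (kacEvolution t μ) (_root_.angularAverage μ)).toReal := by
  have : NeZero n := ⟨by omega⟩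
  have htop := hF.gtwDist_lt_top hα hB
  have htop' := (gtwDist_kacEvolution_angularAverage_le hn μ ht).trans_lt htop
  have h1 := ENNReal.toReal_mono (by finiteness)
    (hF.gtwDist_le_kacEvolution_add hn hα hB hmean ht)
  rw [ENNReal.toReal_add htop'.ne (by finiteness), ENNReal.toReal_ofReal (by positivity)] at h1
  have h2 := (ENNReal.ofReal_le_iff_le_toReal htop.ne).1
    (hF.le_gtwDist hn hα hB (hmean 1 (by norm_num)))
  have h3 : 1 / B * (Real.exp (-1) * (2 / n * (2 * t) ^ (n - 1))) ≤
      (gtwDist μ (_root_.angularAverage μ)).toReal *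
        (Real.exp 1 / n * (2 * t) ^ (n - 1)) := by
    -- The loss is measured against the lower bound `(3/4) e⁻¹/B`, with `2 = (3/4)(8/3)` and `8/3 <
    -- e`.
    calc 1 / B * (Real.exp (-1) * (2 / n * (2 * t) ^ (n - 1)))
        = 1 / B * (Real.exp (-1) * (3 / 4)) * ((8 / 3) / n * (2 * t) ^ (n - 1)) := by ring
      _ ≤ _ := by
        gcongr
        linarith [Real.exp_one_gt_d9]
  linarith

theorem HasSlowFourier.hasDerivWithinAt_gtwDist (hn : 3 ≤ n) [IsProbabilityMeasure μ]
    (hF : HasSlowFourier μ α B g) (hα : 0 ≤ α) (hB : 0 < B)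
    (hmean : ∀ r : ℝ, 1 / 6 ≤ r ^ 2 → 3 / 4 ≤ coordMean n α r) :
    HasDerivWithinAt
      (fun t : ℝ => (gtwDist (kacEvolution t μ) (_root_.angularAverage μ)).toReal)
      0 (Set.Ici 0) 0 := by
  have hn2 : 2 ≤ n := by omega
  have : NeZero n := ⟨by omega⟩
  have htop := hF.gtwDist_lt_top hα hB
  have hle : ∀ t, 0 ≤ t → (gtwDist (kacEvolution t μ) (_root_.angularAverage μ)).toReal ≤
      (gtwDist μ (_root_.angularAverage μ)).toReal := fun t ht =>
    ENNReal.toReal_mono htop.ne (gtwDist_kacEvolution_angularAverage_le hn2 μ ht)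
  have hge := fun (t : ℝ) (ht : 0 ≤ t) => hF.toReal_gtwDist_mul_le hn2 hα hB hmean ht
  -- The upper and lower bounds coincide at `t = 0` because `0 ^ (n - 1) = 0`.
  have h0 : (gtwDist (kacEvolution 0 μ) (_root_.angularAverage μ)).toReal =
      (gtwDist μ (_root_.angularAverage μ)).toReal := by
    refine le_antisymm (hle 0 le_rfl) ?_
    have := hge 0 le_rfl
    rwa [mul_zero, zero_pow (by omega), mul_zero, sub_zero, mul_one] at this
  refine hasDerivWithinAt_zero_of_abs_sub_le (m := n - 1) (by omega)
    (K := (gtwDist μ (_root_.angularAverage μ)).toReal * (Real.exp 1 / n * 2 ^ (n - 1)))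
    fun t ht => ?_
  rw [h0, abs_of_nonpos (sub_nonpos.2 (hle t ht))]
  have := hge t ht
  rw [mul_pow] at this
  linarith

theorem hasSlowFourier_densityLaw_slowDensity (hα : 0 < α) (hB : 0 < B)
    (hnonneg : ∀ v, 0 ≤ slowDensity n α B v) :
    HasSlowFourier (densityLaw (slowDensity n α B)) α B
      fun r => Real.exp (-((1 + α) / 0.9 * r ^ 2)) := fun ξ => by
  obtain ⟨f, hf⟩ := exists_schwartz_slowDensity (n := n) hα B
  have hmeas : Measurable (slowDensity n α B) := by
    rw [← funext hf]
    exact f.continuous.measurable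
  rw [measureFourier_densityLaw hmeas hnonneg, integral_exp_mul_slowDensity hα hB]
  rfl

end SlowDecay

end

/-! ### The theorem and the refutation of (C) -/

theorem theorem2 :
    (∀ n : ℕ, 2 ≤ n →
      ∃ α₀ : ℝ, 0 < α₀ ∧ ∀ α : ℝ, α₀ ≤ α → ∃ B₀ : ℝ, 0 < B₀ ∧ ∀ B : ℝ, B₀ ≤ B →
        -- `f₀` is a Schwartz probability density, symmetric in its variables
        (∃ g : 𝓢(Vel n, ℝ), ∀ v, g v = slowDensity n α B v) ∧
        (∀ v, 0 ≤ slowDensity n α B v) ∧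
        (∫ v, slowDensity n α B v) = 1 ∧
        (∀ (σ : Equiv.Perm (Fin n)) (v : Vel n),
          slowDensity n α B (WithLp.toLp 2 fun i => v (σ i)) = slowDensity n α B v) ∧
        -- its Fourier transform
        (∀ ξ : Vel n, measureFourier (densityLaw (slowDensity n α B)) ξ =
          ((Real.exp (-((1 + α) / 0.9 * ‖ξ‖ ^ 2)) +
            1 / B * (‖ξ‖ ^ 4 * Real.exp (-‖ξ‖ ^ 2) *
              ∏ i : Fin n, (1 - Real.exp (-(α * ξ i ^ 2)))) : ℝ) : ℂ)) ∧
        -- its initial distance to equilibrium is positive and finite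
        0 < gtwDist (densityLaw (slowDensity n α B))
          (angularAverage (densityLaw (slowDensity n α B))) ∧
        gtwDist (densityLaw (slowDensity n α B))
          (angularAverage (densityLaw (slowDensity n α B))) < ∞ ∧
        -- the distance never exceeds its initial value
        (∀ t : ℝ, 0 ≤ t →
          gtwDist (kacEvolution t (densityLaw (slowDensity n α B)))
              (angularAverage (densityLaw (slowDensity n α B))) ≤
            gtwDist (densityLaw (slowDensity n α B))
              (angularAverage (densityLaw (slowDensity n α B)))) ∧
        -- the lower bound
        (∀ t : ℝ, 0 ≤ t →
          max ((gtwDist (densityLaw (slowDensity n α B))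
                (angularAverage (densityLaw (slowDensity n α B)))).toReal *
              (1 - Real.exp 1 / n * (2 * t) ^ (n - 1))) 0 ≤
            (gtwDist (kacEvolution t (densityLaw (slowDensity n α B)))
              (angularAverage (densityLaw (slowDensity n α B)))).toReal) ∧
        -- in particular almost nothing is lost up to time `1/2`
        (∀ t : ℝ, 0 ≤ t → t ≤ 1 / 2 →
          (gtwDist (densityLaw (slowDensity n α B))
              (angularAverage (densityLaw (slowDensity n α B)))).toReal *
              (1 - Real.exp 1 / n) ≤
            (gtwDist (kacEvolution t (densityLaw (slowDensity n α B)))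
              (angularAverage (densityLaw (slowDensity n α B)))).toReal) ∧
        -- the initial derivative of the distance vanishes
        (3 ≤ n →
          HasDerivWithinAt
            (fun t : ℝ => (gtwDist (kacEvolution t (densityLaw (slowDensity n α B)))
              (angularAverage (densityLaw (slowDensity n α B)))).toReal)
            0 (Set.Ici 0) 0)) ∧
    -- the Cercignani-type statement is false
    ¬ CercignaniGTW := by
  refine ⟨fun n hn => ?_, ?_⟩
  · have : NeZero n := ⟨by omega⟩
    obtain ⟨α₀, hα₀, hmean⟩ := exists_le_coordMean n (β := 3 / 4) (ρ := 1 / 6)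
      (by norm_num) (by norm_num)
    refine ⟨α₀, hα₀, fun α hα => ?_⟩
    have hα0 : 0 < α := hα₀.trans_le hα
    obtain ⟨B₀, hB₀, hnonneg⟩ := exists_slowDensity_nonneg (n := n) hα0
    refine ⟨B₀, hB₀, fun B hB => ?_⟩
    have hB0 : 0 < B := hB₀.trans_le hB
    have hF := hasSlowFourier_densityLaw_slowDensity hα0 hB0 (hnonneg B hB)
    have hone := integral_slowDensity (n := n) hα0 hB0
    have := isProbabilityMeasure_densityLaw (hnonneg B hB) hone
    have hlower := fun (t : ℝ) (ht : 0 ≤ t) =>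
      hF.toReal_gtwDist_mul_le hn hα0.le hB0 (hmean α hα) ht
    refine ⟨exists_schwartz_slowDensity hα0 B, hnonneg B hB, hone,
      fun σ v => slowDensity_perm σ α B v, hF, ?_, hF.gtwDist_lt_top hα0.le hB0,
      fun t ht => gtwDist_kacEvolution_angularAverage_le hn _ ht,
      fun t ht => max_le (hlower t ht) ENNReal.toReal_nonneg, fun t ht ht2 => ?_,
      fun h3 => hF.hasDerivWithinAt_gtwDist h3 hα0.le hB0 (hmean α hα)⟩
    · refine lt_of_lt_of_le (ENNReal.ofReal_pos.2 ?_)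
        (hF.le_gtwDist hn hα0.le hB0 (hmean α hα 1 (by norm_num)))
      positivity
    · refine le_trans ?_ (hlower t ht)
      gcongr
      exact mul_le_of_le_one_right (by positivity) (pow_le_one₀ (by positivity) (by linarith))
  · rintro ⟨a, ha, hC⟩
    -- Three is the least `n` for which the loss bound of order `t^{n-1}` is `o(t)`.
    obtain ⟨α, hα, hmean⟩ := exists_le_coordMean 3 (β := 3 / 4) (ρ := 1 / 6)
      (by norm_num) (by norm_num)
    obtain ⟨B, hB, hnonneg⟩ := exists_slowDensity_nonneg (n := 3) hα
    have h0 := hnonneg B le_rfl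
    have hF := hasSlowFourier_densityLaw_slowDensity hα hB h0
    have hprob := isProbabilityMeasure_densityLaw h0 (integral_slowDensity (n := 3) hα hB)
    obtain ⟨f, hf⟩ := exists_schwartz_slowDensity (n := 3) hα B
    have hfun : slowDensity 3 α B = f := (funext hf).symm
    have key := hC 3 (by norm_num) (densityLaw (slowDensity 3 α B)) hprob
      (by rw [hfun]; exact integrable_norm_sq_densityLaw f fun v => by rw [hf]; exact h0 v)
      (integral_densityLaw_eq_zero (by rw [hfun]; exact f.continuous.measurable)
        (slowDensity_neg α B))
      (lt_of_lt_of_le (ENNReal.ofReal_pos.2 (by positivity))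
        (hF.le_gtwDist (by norm_num) hα.le hB (hmean α le_rfl 1 (by norm_num))))
      0 (hF.hasDerivWithinAt_gtwDist le_rfl hα.le hB (hmean α le_rfl))
    rw [neg_zero, zero_div] at key
    exact absurd key (not_le.2 ha)
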